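/- Let $P\subset\mathbb{R}^d$ be a closed convex cone which is spanning ($P-P=\mathbb{R}^d$) and pointed ($P\cap(-P)=\{0\}$), with interior $\Omega$. Let $K$ be a separable complex Hilbert space (inner products are linear in the second variable). Let $V=\{V_x\}_{x\in P}$ be an isometric representation of $P$ on $K$: every $V_x$ is an isometry, $V_{x+y}=V_xV_y$ for $x,y\in P$, and $x\mapsto V_x\xi$ is continuous for every $\xi\in K$. Assume that $V$ is strictly continuous, i.e. $x\mapsto V_x^*\xi$ is also continuous for every $\xi\in K$, and pure, i.e. $\bigcap_{t\ge 0}V_{ta}K=\{0\}$ for every $a\in\Omega$. Let $\Gamma(K)$ be the symmetric Fock space of $K$, with exponential vectors $e(u)=\sum_{n\ge0}u^{\otimes n}/\sqrt{n!}$. For $x\in P$ identify $\Gamma(K)=\Gamma(\ker V_x^*)\otimes\Gamma(V_xK)$ by $e(u+v)\leftrightarrow e(u)\otimes e(v)$ ($u\in\ker V_x^*$, $v\in V_xK$), and let $\Gamma(V_x):\Gamma(K)\to\Gamma(V_xK)$ be the unitary with $\Gamma(V_x)e(v)=e(V_xv)$. The CCR flow $\alpha^V=\{\alpha^V_x\}_{x\in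 P}$ is given by $$\alpha^V_x(T)=1_{\Gamma(\ker V_x^*)}\otimes\Gamma(V_x)T\Gamma(V_x)^*,\qquad T\in B(\Gamma(K)).$$ A unit of $\alpha^V$ is a strongly continuous family $\{u_x\}_{x\in P}$ of bounded operators on $\Gamma(K)$ such that $\alpha^V_x(T)u_x=u_xT$ for all $x\in P$, $T\in B(\Gamma(K))$; $u_{x+y}=u_xu_y$ for all $x,y\in P$; and $u_x\ne0$ for some $x\in P$. A $P$-additive cocycle of $V$ is a continuous map $h:P\to K$ with $h_x\in\ker V_x^*$ and $h_{x+y}=h_x+V_xh_y$ for all $x,y\in P$. For $x\in P$ and $\xi\in\Gamma(\ker V_x^*)$ let $R^{\xi}\in B(\Gamma(K))$ be the operator $R^\xi\eta=\xi\otimes\Gamma(V_x)\eta$. For $\mu\in\mathbb{C}^d$ and a $P$-additive cocycle $h$ of $V$ put $T^{\mu,h}=\{T^{\mu,h}_x\}_{x\in P}$, where $$T^{\mu,h}_x=e^{\langle x,\mu\rangle}R^{e(h_x)},\qquad \langle x,\mu\rangle=\sum_{i=1}^d x_i\mu_i .$$ Then $(\mu,h)\mapsto T^{\mu,h}$ is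 a bijection from $\mathbb{C}^d\times\{P\text{-additive cocycles of }V\}$ onto the set of all units of $\alpha^V$. -/

import Mathlib

open scoped TensorProduct InnerProductSpace Nat

universe u

noncomputable section

namespace CCR

/-! ### Hilbert tensor powers -/

/-- A bundled complex inner product space (used to define tensor powers by recursion). -/
structure InnerSpace where
  carrier : Type u
  [group : NormedAddCommGroup carrier]
  [inner : InnerProductSpace ℂ carrier]

instance (X : InnerSpace.{u}) : NormedAddCommGroup X.carrier := X.group

instance (X : InnerSpace.{u}) : InnerProductSpace ℂ X.carrier := X.inner

section Fock

variable (K : Type u) [NormedAddCommGroup K] [InnerProductSpace ℂ K]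

/-- Auxiliary recursion: `ℂ`, `K ⊗ ℂ`, `K ⊗ (K ⊗ ℂ)`, … with their tensor product inner products.
The starting space `EuclideanSpace ℂ PUnit` is a copy of `ℂ` in the universe of `K`. -/
def algTensorPowerAux : ℕ → InnerSpace.{u}
  | 0 => ⟨EuclideanSpace ℂ PUnit.{u + 1}⟩
  | n + 1 => ⟨K ⊗[ℂ] (algTensorPowerAux n).carrier⟩

/-- The algebraic `n`-th tensor power of `K`, an inner product space. -/
abbrev AlgTensorPower (n : ℕ) : Type u := (algTensorPowerAux K n).carrier

/-- The elementary tensor `v₁ ⊗ ⋯ ⊗ vₙ`, as a multilinear map of `v`. -/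
def pureTensor : (n : ℕ) → MultilinearMap ℂ (fun _ : Fin n => K) (AlgTensorPower K n)
  | 0 => MultilinearMap.constOfIsEmpty ℂ _
      (EuclideanSpace.single PUnit.unit (1 : ℂ) : EuclideanSpace ℂ PUnit.{u + 1})
  | n + 1 => LinearMap.uncurryLeft (M := fun _ => K)
      { toFun := fun k =>
          (TensorProduct.mk ℂ K (AlgTensorPower K n) k).compMultilinearMap (pureTensor n)
        map_add' := fun k l => MultilinearMap.ext fun v => TensorProduct.add_tmul k l (pureTensor n v)
        map_smul' := fun c k => MultilinearMap.ext fun v =>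
          TensorProduct.smul_tmul' c k (pureTensor n v) }

/-- The Hilbert space tensor power `K ⊗ ⋯ ⊗ K` (`n` factors). -/
abbrev TensorPower (n : ℕ) : Type u := UniformSpace.Completion (AlgTensorPower K n)

variable {K}

theorem pureTensor_succ (n : ℕ) (v : Fin (n + 1) → K) :
    pureTensor K (n + 1) v =
      (v 0 ⊗ₜ[ℂ] pureTensor K n (Fin.tail v) : K ⊗[ℂ] AlgTensorPower K n) := rfl

theorem inner_pureTensor (n : ℕ) (v w : Fin n → K) :
    ⟪pureTensor K n v, pureTensor K n w⟫_ℂ = ∏ i, ⟪v i, w i⟫_ℂ := by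
  induction n with
  | zero =>
    change ⟪(EuclideanSpace.single PUnit.unit (1 : ℂ) : EuclideanSpace ℂ PUnit.{u + 1}),
      EuclideanSpace.single PUnit.unit (1 : ℂ)⟫_ℂ = _
    simp
  | succ n ih =>
    rw [pureTensor_succ, pureTensor_succ, Fin.prod_univ_succ]
    refine (TensorProduct.inner_tmul (𝕜 := ℂ) _ _ _ _).trans ?_
    rw [ih]
    rfl

theorem norm_pureTensor (n : ℕ) (v : Fin n → K) : ‖pureTensor K n v‖ = ∏ i, ‖v i‖ := by
  have h : ((‖pureTensor K n v‖ ^ 2 : ℝ) : ℂ) = (((∏ i, ‖v i‖) ^ 2 : ℝ) : ℂ) := by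
    have := inner_pureTensor n v v
    simp only [inner_self_eq_norm_sq_to_K] at this
    rw [Complex.ofReal_pow]
    refine this.trans ?_
    rw [Finset.prod_pow]
    push_cast
    rfl
  have h' : ‖pureTensor K n v‖ ^ 2 = (∏ i, ‖v i‖) ^ 2 := by exact_mod_cast h
  exact (pow_left_inj₀ (norm_nonneg _) (Finset.prod_nonneg fun i _ => norm_nonneg _) two_ne_zero).1 h'

theorem span_pureTensor (n : ℕ) : Submodule.span ℂ (Set.range (pureTensor K n)) = ⊤ := by
  induction n with
  | zero =>
    rw [eq_top_iff]
    rintro (x : EuclideanSpace ℂ PUnit.{u + 1}) -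
    have : x = x PUnit.unit • pureTensor K 0 (fun i => i.elim0) := by
      change x = x PUnit.unit •
        (EuclideanSpace.single PUnit.unit (1 : ℂ) : EuclideanSpace ℂ PUnit.{u + 1})
      ext i
      simp
    rw [this]
    exact Submodule.smul_mem _ _ (Submodule.subset_span ⟨_, rfl⟩)
  | succ n ih =>
    rw [eq_top_iff]
    rintro (x : K ⊗[ℂ] AlgTensorPower K n) -
    induction x using TensorProduct.induction_on with
    | zero => exact Submodule.zero_mem _
    | add x y hx hy => exact Submodule.add_mem _ hx hy
    | tmul k y =>
      have hy : y ∈ Submodule.span ℂ (Set.range (pureTensor K n)) := ih ▸ Submodule.mem_top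
      induction hy using Submodule.span_induction with
      | mem y hy =>
        obtain ⟨v, rfl⟩ := hy
        exact Submodule.subset_span ⟨Fin.cons k v, rfl⟩
      | zero => rw [TensorProduct.tmul_zero]; exact Submodule.zero_mem _
      | add y z _ _ hy hz => rw [TensorProduct.tmul_add]; exact Submodule.add_mem _ hy hz
      | smul c y _ hy => rw [TensorProduct.tmul_smul]; exact Submodule.smul_mem _ _ hy

/-! ### The symmetric Fock space -/

variable (K)

/-- The symmetric part of the `n`-th Hilbert tensor power: the vectors invariant under the unitary
permutation operators `v₁ ⊗ ⋯ ⊗ vₙ ↦ v_{σ(1)} ⊗ ⋯ ⊗ v_{σ(n)}`. As elementary tensors are total, the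
invariance of `w` can be tested on the inner products of `w` with elementary tensors. -/
def symTensorPower (n : ℕ) : Submodule ℂ (TensorPower K n) where
  carrier := {w | ∀ (σ : Equiv.Perm (Fin n)) (v : Fin n → K),
    ⟪((pureTensor K n (fun i => v (σ i)) : AlgTensorPower K n) : TensorPower K n), w⟫_ℂ =
      ⟪((pureTensor K n v : AlgTensorPower K n) : TensorPower K n), w⟫_ℂ}
  add_mem' := fun ha hb σ v => by rw [inner_add_right, inner_add_right, ha σ v, hb σ v]
  zero_mem' := fun σ v => by simp
  smul_mem' := fun c w hw σ v => by rw [inner_smul_right, inner_smul_right, hw σ v]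

instance (n : ℕ) : CompleteSpace (symTensorPower K n) := by
  have h : IsClosed (symTensorPower K n : Set (TensorPower K n)) := by
    change IsClosed {w : TensorPower K n | ∀ (σ : Equiv.Perm (Fin n)) (v : Fin n → K), _ = _}
    simp only [Set.ofPred_forall]
    exact isClosed_iInter fun σ => isClosed_iInter fun v =>
      isClosed_eq (by fun_prop) (by fun_prop)
  exact h.completeSpace_coe

/-- The symmetric Fock space `Γ(K)`: the Hilbert space direct sum of the symmetric parts of the
Hilbert tensor powers of `K`. -/
abbrev Fock : Type u := lp (fun n : ℕ => symTensorPower K n) 2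

variable {K}

/-- The vector `u ⊗ ⋯ ⊗ u` (`n` factors) of the symmetric tensor power. -/
def symPow (n : ℕ) (v : K) : symTensorPower K n :=
  ⟨((pureTensor K n (fun _ => v) : AlgTensorPower K n) : TensorPower K n), fun σ w => by
    simp only [UniformSpace.Completion.inner_coe, inner_pureTensor]
    exact Equiv.prod_comp σ (fun i => ⟪w i, v⟫_ℂ)⟩

theorem inner_symPow (n : ℕ) (v w : K) : ⟪symPow n v, symPow n w⟫_ℂ = ⟪v, w⟫_ℂ ^ n := by
  rw [Submodule.coe_inner]
  simp [symPow, inner_pureTensor]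

theorem norm_symPow (n : ℕ) (v : K) : ‖symPow n v‖ = ‖v‖ ^ n := by
  rw [Submodule.coe_norm]
  simp [symPow, norm_pureTensor]

/-- The exponential vector `e(v) = ∑ₙ v^{⊗ n} / √(n!)`. -/
def expVec (v : K) : Fock K :=
  ⟨fun n => ((Real.sqrt (n ! : ℝ) : ℂ))⁻¹ • symPow n v, by
    refine memℓp_gen ?_
    have h := Real.summable_pow_div_factorial (‖v‖ ^ 2)
    refine h.congr fun n => ?_
    rw [norm_smul, norm_symPow, norm_inv, Complex.norm_real, Real.norm_of_nonneg (Real.sqrt_nonneg _)]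
    simp only [ENNReal.toReal_ofNat, Real.rpow_ofNat]
    rw [mul_pow, inv_pow, Real.sq_sqrt (by positivity)]
    ring⟩

theorem inner_expVec (v w : K) : ⟪expVec v, expVec w⟫_ℂ = Complex.exp ⟪v, w⟫_ℂ := by
  refine (lp.hasSum_inner (expVec v) (expVec w)).unique ?_
  rw [Complex.exp_eq_exp_ℂ]
  convert NormedSpace.expSeries_div_hasSum_exp (𝔸 := ℂ) ⟪v, w⟫_ℂ using 2 with n
  have h : ((Real.sqrt (n ! : ℝ) : ℂ)) * (Real.sqrt (n ! : ℝ) : ℂ) = (n ! : ℂ) := by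
    rw [← Complex.ofReal_mul, Real.mul_self_sqrt (by positivity)]
    simp
  change ⟪((Real.sqrt (n ! : ℝ) : ℂ))⁻¹ • symPow n v,
    ((Real.sqrt (n ! : ℝ) : ℂ))⁻¹ • symPow n w⟫_ℂ = _
  refine (inner_smul_left (𝕜 := ℂ) (symPow n v) _ _).trans ?_
  refine (congrArg _ (inner_smul_right (𝕜 := ℂ) (symPow n v) (symPow n w) _)).trans ?_
  rw [inner_symPow, map_inv₀, Complex.conj_ofReal, ← h]
  field_simp

/-- Exponential vectors are total in the symmetric Fock space. -/
theorem span_expVec [CompleteSpace K] :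
    (Submodule.span ℂ (Set.range (expVec : K → Fock K))).topologicalClosure = ⊤ := by
  rw [Submodule.topologicalClosure_eq_top_iff, eq_bot_iff]
  intro w hw
  -- all the coefficients of the power series `t ↦ ⟪w, e(t u)⟫` vanish
  have h1 : ∀ (n : ℕ) (u : K), ⟪w n, symPow n u⟫_ℂ = 0 := by
    intro n u
    have hpow : ∀ (t : ℂ) (k : ℕ), symPow k (t • u) = t ^ k • symPow k u := by
      intro t k
      refine Subtype.ext ?_
      change ((pureTensor K k (fun _ => t • u) : AlgTensorPower K k) : TensorPower K k) =
        t ^ k • ((pureTensor K k (fun _ => u) : AlgTensorPower K k) : TensorPower K k)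
      rw [MultilinearMap.map_smul_univ, UniformSpace.Completion.coe_smul]
      simp
    set c : ℕ → ℂ := fun k => ((Real.sqrt (k ! : ℝ) : ℂ))⁻¹ * ⟪w k, symPow k u⟫_ℂ with hc
    have hsum : ∀ t : ℂ, HasSum (fun k => t ^ k * c k) 0 := by
      intro t
      have h := lp.hasSum_inner (𝕜 := ℂ) w (expVec (t • u))
      rw [(Submodule.mem_orthogonal' _ w).1 hw _ (Submodule.subset_span ⟨_, rfl⟩)] at h
      refine (congrArg (fun f : ℕ → ℂ => HasSum f 0) (funext fun k => ?_)).mpr h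
      change _ = ⟪w k, ((Real.sqrt (k ! : ℝ) : ℂ))⁻¹ • symPow k (t • u)⟫_ℂ
      rw [hpow]
      refine Eq.symm ((inner_smul_right (𝕜 := ℂ) (w k) _ _).trans ?_)
      refine (congrArg _ (inner_smul_right (𝕜 := ℂ) (w k) (symPow k u) _)).trans ?_
      rw [hc]
      ring
    have hp : HasFPowerSeriesAt (fun _ : ℂ => (0 : ℂ)) (FormalMultilinearSeries.ofScalars ℂ c) 0 := by
      refine hasFPowerSeriesAt_iff.2 (Filter.Eventually.of_forall fun t => ?_)
      simpa only [FormalMultilinearSeries.coeff_ofScalars, smul_eq_mul] using hsum t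
    have h0 := congrArg (fun p => FormalMultilinearSeries.coeff p n) hp.eq_zero
    have h0' : c n = 0 := by
      rw [FormalMultilinearSeries.coeff_ofScalars] at h0
      exact h0
    refine (mul_eq_zero.1 h0').resolve_left ?_
    refine inv_ne_zero ?_
    rw [Complex.ofReal_ne_zero]
    positivity
  have h2 : ∀ n, w n = 0 := by
    intro n
    have h3 : ∀ v : Fin n → K,
        ⟪(w n : TensorPower K n), ((pureTensor K n v : AlgTensorPower K n) : TensorPower K n)⟫_ℂ
          = 0 := by
      intro v
      let f : ContinuousMultilinearMap ℂ (fun _ : Fin n => K) ℂ :=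
        (((innerSL ℂ (w n : TensorPower K n)).toLinearMap ∘ₗ
          (UniformSpace.Completion.toComplL (𝕜 := ℂ)
            (E := AlgTensorPower K n)).toLinearMap).compMultilinearMap
            (pureTensor K n)).mkContinuous ‖w n‖ fun m => by
          refine (norm_inner_le_norm (𝕜 := ℂ) (w n : TensorPower K n)
            ((pureTensor K n m : AlgTensorPower K n) : TensorPower K n)).trans ?_
          rw [UniformSpace.Completion.norm_coe, norm_pureTensor]
          rfl
      have hf : ∀ m, f m = ⟪(w n : TensorPower K n),
          ((pureTensor K n m : AlgTensorPower K n) : TensorPower K n)⟫_ℂ := fun m => rfl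
      have hd : (fun x : K => f (fun _ => x)) = fun _ => 0 := funext fun x => h1 n x
      have h4 := f.iteratedFDeriv_comp_diagonal 0 v
      have h5 : ∀ σ : Equiv.Perm (Fin n), f (fun i => v (σ i)) = f v := by
        intro σ
        rw [hf, hf, ← inner_conj_symm, (w n).2 σ v, inner_conj_symm]
      rw [hd] at h4
      simp only [h5, Finset.sum_const, Finset.card_univ] at h4
      rw [← hf]
      rcases eq_or_ne n 0 with rfl | hn
      · have := congrFun hd 0
        rw [Subsingleton.elim v (fun _ => 0)]
        exact this
      · rw [iteratedFDeriv_const_of_ne hn] at h4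
        simpa [Fintype.card_ne_zero] using h4.symm
    have h6 : ∀ x : TensorPower K n, ⟪(w n : TensorPower K n), x⟫_ℂ = 0 := by
      intro x
      induction x using UniformSpace.Completion.induction_on with
      | hp => exact isClosed_eq (by fun_prop) (by fun_prop)
      | ih y =>
        have hy : y ∈ Submodule.span ℂ (Set.range (pureTensor K n)) :=
          span_pureTensor (K := K) n ▸ Submodule.mem_top
        induction hy using Submodule.span_induction with
        | mem y hy =>
          obtain ⟨v, rfl⟩ := hy
          exact h3 v
        | zero => rw [UniformSpace.Completion.coe_zero, inner_zero_right]
        | add y z _ _ hy hz => rw [UniformSpace.Completion.coe_add, inner_add_right, hy, hz, add_zero]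
        | smul c y _ hy => rw [UniformSpace.Completion.coe_smul, inner_smul_right, hy, mul_zero]
    exact Subtype.ext (inner_self_eq_zero.1 (h6 _))
  exact lp.ext (funext h2)

end Fock

/-! ### Hilbert space tensor products and operators given on total sets -/

section Tensor

/-- The Hilbert space tensor product. -/
abbrev HilbertTensor (X Y : Type u) [NormedAddCommGroup X] [InnerProductSpace ℂ X]
    [NormedAddCommGroup Y] [InnerProductSpace ℂ Y] : Type u :=
  UniformSpace.Completion (X ⊗[ℂ] Y)

variable {X Y : Type u} [NormedAddCommGroup X] [InnerProductSpace ℂ X]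
  [NormedAddCommGroup Y] [InnerProductSpace ℂ Y]

/-- The bounded operator `y ↦ x ⊗ y` into the Hilbert space tensor product. -/
def tensorLeft (x : X) : Y →L[ℂ] HilbertTensor X Y :=
  (UniformSpace.Completion.toComplL (𝕜 := ℂ) (E := X ⊗[ℂ] Y)) ∘L (TensorProduct.mkL ℂ X Y x)

theorem inner_tensorLeft (x x' : X) (y y' : Y) :
    ⟪tensorLeft x y, tensorLeft x' y'⟫_ℂ = ⟪x, x'⟫_ℂ * ⟪y, y'⟫_ℂ := by
  refine (UniformSpace.Completion.inner_coe _ _).trans ?_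
  exact TensorProduct.inner_tmul (𝕜 := ℂ) _ _ _ _

/-- The bounded operator `1 ⊗ T` on the Hilbert space tensor product. -/
def ampliation (X : Type u) [NormedAddCommGroup X] [InnerProductSpace ℂ X] (T : Y →L[ℂ] Y) :
    HilbertTensor X Y →L[ℂ] HilbertTensor X Y :=
  (T.lTensor X).completion

theorem ampliation_tensorLeft (T : Y →L[ℂ] Y) (x : X) (y : Y) :
    ampliation X T (tensorLeft x y) = tensorLeft x (T y) := by
  refine (UniformSpace.Completion.map_coe
    (ContinuousLinearMap.uniformContinuous (T.lTensor X)) _).trans ?_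
  rfl

theorem span_tensorLeft {ι κ : Type*} (a : ι → X) (b : κ → Y)
    (ha : (Submodule.span ℂ (Set.range a)).topologicalClosure = ⊤)
    (hb : (Submodule.span ℂ (Set.range b)).topologicalClosure = ⊤) :
    (Submodule.span ℂ (Set.range fun p : ι × κ =>
      tensorLeft (a p.1) (b p.2))).topologicalClosure = ⊤ := by
  set S := (Submodule.span ℂ (Set.range fun p : ι × κ =>
      tensorLeft (a p.1) (b p.2))).topologicalClosure with hS
  have hSc : IsClosed (S : Set (HilbertTensor X Y)) := Submodule.isClosed_topologicalClosure _
  have h1 : ∀ (i : ι) (y : Y), tensorLeft (a i) y ∈ S := by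
    intro i y
    have h : (⊤ : Submodule ℂ Y) ≤ S.comap (tensorLeft (a i)).toLinearMap := by
      rw [← hb]
      refine Submodule.topologicalClosure_minimal _ (Submodule.span_le.2 ?_)
        (hSc.preimage (tensorLeft (a i)).continuous)
      rintro _ ⟨k, rfl⟩
      exact Submodule.le_topologicalClosure _ (Submodule.subset_span ⟨(i, k), rfl⟩)
    exact h Submodule.mem_top
  have h2 : ∀ (x : X) (y : Y), tensorLeft x y ∈ S := by
    intro x y
    let f : X →L[ℂ] HilbertTensor X Y :=
      (UniformSpace.Completion.toComplL (𝕜 := ℂ) (E := X ⊗[ℂ] Y)) ∘L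
        ((TensorProduct.mkL ℂ X Y).flip y)
    have h : (⊤ : Submodule ℂ X) ≤ S.comap f.toLinearMap := by
      rw [← ha]
      refine Submodule.topologicalClosure_minimal _ (Submodule.span_le.2 ?_)
        (hSc.preimage f.continuous)
      rintro _ ⟨i, rfl⟩
      exact h1 i y
    exact h Submodule.mem_top
  rw [eq_top_iff]
  rintro x -
  induction x using UniformSpace.Completion.induction_on with
  | hp => exact hSc
  | ih z =>
    induction z using TensorProduct.induction_on with
    | zero => rw [UniformSpace.Completion.coe_zero]; exact S.zero_mem
    | add z w hz hw =>
      rw [UniformSpace.Completion.coe_add]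
      exact S.add_mem hz hw
    | tmul x y => exact h2 x y

/-- The bounded operator `X → Y` sending `a i` to `b i` for all `i`, where `a` is a total family in
`X` and `b` is a family in the Hilbert space `Y` with the same inner products. -/
def extendTotal {ι : Type*} [CompleteSpace Y] (a : ι → X) (b : ι → Y) : X →L[ℂ] Y :=
  (Finsupp.linearCombination ℂ b).extendOfNorm (Finsupp.linearCombination ℂ a)

theorem extendTotal_apply {ι : Type*} [CompleteSpace Y] (a : ι → X) (b : ι → Y)
    (ha : (Submodule.span ℂ (Set.range a)).topologicalClosure = ⊤)
    (hab : ∀ i j, ⟪b i, b j⟫_ℂ = ⟪a i, a j⟫_ℂ) (i : ι) : extendTotal a b (a i) = b i := by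
  have hd : DenseRange (Finsupp.linearCombination ℂ a) := by
    rw [DenseRange, ← LinearMap.coe_range, Finsupp.range_linearCombination,
      ← Submodule.dense_iff_topologicalClosure_eq_top] at *
    exact ha
  have hn : ∀ x : ι →₀ ℂ, ‖Finsupp.linearCombination ℂ b x‖ ≤
      1 * ‖Finsupp.linearCombination ℂ a x‖ := by
    intro x
    rw [one_mul, @norm_eq_sqrt_re_inner ℂ, @norm_eq_sqrt_re_inner ℂ]
    simp only [Finsupp.linearCombination_apply, Finsupp.sum, sum_inner, inner_sum,
      inner_smul_left, inner_smul_right, hab]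
    exact le_rfl
  have h := LinearMap.extendOfNorm_eq hd ⟨1, hn⟩ (Finsupp.single i 1)
  simpa [extendTotal] using h

end Tensor

/-! ### Isometric representations, CCR flows and units -/

section Flow

variable {K : Type u} [NormedAddCommGroup K] [InnerProductSpace ℂ K] [CompleteSpace K]

/-- For an isometry `v` of `K`, the canonical unitary
`Γ(ker v*) ⊗ Γ(K) → Γ(ker v*) ⊗ Γ(v K) = Γ(ker v* ⊕ v K) = Γ(K)`, that is, `1 ⊗ Γ(v)` followed by
the exponential identification; it sends `e(k) ⊗ e(w)` to `e(k + v w)`. -/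
def fockUnitary (v : K →L[ℂ] K) :
    HilbertTensor (Fock (LinearMap.ker v.adjoint.toLinearMap)) (Fock K) →L[ℂ] Fock K :=
  extendTotal
    (fun p : LinearMap.ker v.adjoint.toLinearMap × K => tensorLeft (expVec p.1) (expVec p.2))
    (fun p => expVec ((p.1 : K) + v p.2))

theorem fockUnitary_apply (v : K →L[ℂ] K) (hv : ∀ ξ, ‖v ξ‖ = ‖ξ‖)
    (k : LinearMap.ker v.adjoint.toLinearMap) (w : K) :
    fockUnitary v (tensorLeft (expVec k) (expVec w)) = expVec ((k : K) + v w) := by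
  refine extendTotal_apply
    (fun p : LinearMap.ker v.adjoint.toLinearMap × K => tensorLeft (expVec p.1) (expVec p.2))
    (fun p => expVec ((p.1 : K) + v p.2)) ?_ ?_ (k, w)
  · exact span_tensorLeft _ _ span_expVec span_expVec
  · rintro ⟨k, w⟩ ⟨k', w'⟩
    have h1 : ⟪(k : K), v w'⟫_ℂ = 0 := by
      rw [← ContinuousLinearMap.adjoint_inner_left, show v.adjoint (k : K) = 0 from k.2,
        inner_zero_left]
    have h2 : ⟪v w, (k' : K)⟫_ℂ = 0 := by
      rw [← ContinuousLinearMap.adjoint_inner_right, show v.adjoint (k' : K) = 0 from k'.2,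
        inner_zero_right]
    have h3 : ⟪v w, v w'⟫_ℂ = ⟪w, w'⟫_ℂ :=
      LinearIsometry.inner_map_map ⟨v.toLinearMap, hv⟩ w w'
    rw [inner_tensorLeft, inner_expVec, inner_expVec, inner_expVec, ← Complex.exp_add,
      inner_add_left, inner_add_right, inner_add_right, h1, h2, h3, Submodule.coe_inner]
    simp

variable {d : ℕ} {P : PointedCone ℝ (EuclideanSpace ℝ (Fin d))}

/-- An isometric representation of the cone `P` on `K`: a strongly continuous semigroup of
isometries indexed by `P`. -/
structure IsometricRep (P : PointedCone ℝ (EuclideanSpace ℝ (Fin d))) (K : Type u)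
    [NormedAddCommGroup K] [InnerProductSpace ℂ K] where
  toFun : P → K →L[ℂ] K
  isometry : ∀ x ξ, ‖toFun x ξ‖ = ‖ξ‖
  map_add : ∀ x y, toFun (x + y) = toFun x ∘L toFun y
  continuous : ∀ ξ, Continuous fun x => toFun x ξ

instance : CoeFun (IsometricRep P K) fun _ => P → K →L[ℂ] K := ⟨IsometricRep.toFun⟩

/-- `V` is strictly continuous if also `x ↦ V_x* ξ` is continuous for all `ξ`. -/
def IsometricRep.StrictlyContinuous (V : IsometricRep P K) : Prop :=
  ∀ ξ, Continuous fun x => (V x).adjoint ξ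

/-- `V` is pure if `⋂_{t ≥ 0} V_{ta} K = {0}` for every `a` in the interior of `P`. -/
def IsometricRep.Pure (V : IsometricRep P K) : Prop :=
  ∀ a : P, (a : EuclideanSpace ℝ (Fin d)) ∈ interior (P : Set (EuclideanSpace ℝ (Fin d))) →
    (⋂ t : {t : ℝ // 0 ≤ t}, Set.range (V (t • a))) = {0}

/-- The CCR flow of `V`: the maps
`α_x(T) = 1_{Γ(ker V_x*)} ⊗ Γ(V_x) T Γ(V_x)*` on the bounded operators of `Γ(K)`. -/
def ccrFlow (V : IsometricRep P K) (x : P) (T : Fock K →L[ℂ] Fock K) : Fock K →L[ℂ] Fock K :=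
  fockUnitary (V x) ∘L ampliation _ T ∘L (fockUnitary (V x)).adjoint

/-- A unit of a family `α_x`, `x ∈ P`, of maps on the bounded operators of a Hilbert space `H`. -/
structure IsUnitOf {H : Type u} [NormedAddCommGroup H] [InnerProductSpace ℂ H]
    (α : P → (H →L[ℂ] H) → (H →L[ℂ] H)) (u : P → H →L[ℂ] H) : Prop where
  continuous : ∀ ξ, Continuous fun x => u x ξ
  intertwines : ∀ x T, α x T ∘L u x = u x ∘L T
  map_add : ∀ x y, u (x + y) = u x ∘L u y
  nonzero : ∃ x, u x ≠ 0

/-- The set of all units of `α`. -/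
def units {H : Type u} [NormedAddCommGroup H] [InnerProductSpace ℂ H]
    (α : P → (H →L[ℂ] H) → (H →L[ℂ] H)) : Set (P → H →L[ℂ] H) :=
  {u | IsUnitOf α u}

/-- A `P`-additive cocycle of `V`: a continuous map `h : P → K` with `h_x ∈ ker V_x*` and
`h_{x+y} = h_x + V_x h_y`. -/
structure AdditiveCocycle (V : IsometricRep P K) where
  toFun : P → K
  continuous : Continuous toFun
  mem_ker : ∀ x, toFun x ∈ LinearMap.ker (V x).adjoint.toLinearMap
  map_add : ∀ x y, toFun (x + y) = toFun x + V x (toFun y)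

/-- The operator `R^ξ : η ↦ ξ ⊗ Γ(V_x) η` on `Γ(K)`, for `ξ ∈ Γ(ker V_x*)`. -/
def creation (V : IsometricRep P K) (x : P)
    (ξ : Fock (LinearMap.ker (V x).adjoint.toLinearMap)) : Fock K →L[ℂ] Fock K :=
  fockUnitary (V x) ∘L tensorLeft ξ

/-- The family `T^{μ,h}_x = e^{⟨x, μ⟩} R^{e(h_x)}`, where `⟨x, μ⟩ = ∑ i, x_i μ_i`. -/
def unitFamily (V : IsometricRep P K) (μ : Fin d → ℂ) (h : AdditiveCocycle V) (x : P) :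
    Fock K →L[ℂ] Fock K :=
  Complex.exp (∑ i, ((x : EuclideanSpace ℝ (Fin d)) i : ℂ) * μ i) •
    creation V x (expVec ⟨h.toFun x, h.mem_ker x⟩)

end Flow

end CCR

end

/-! Write `W` for the canonical isometry of Γ(ker V_x*) ⊗ Γ(K) into Γ(K). If u is a unit, then
`W.adjoint ∘L u x` commutes with every 1 ⊗ T, and testing on rank-one T gives u_x = R^ξ for some ξ
(`exists_eq_creation`). So u_x is determined by u_x e(0), and the semigroup law becomes ⟨e(v),
u_{x+y} e(0)⟩ = ⟨e(v), u_x e(0)⟩ ⟨e(V_x* v), u_y e(0)⟩.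

At v = 0 this says that the vacuum expectation is a continuous character of P. It equals 1 at x = 0,
so it has the form e^{⟨x,μ⟩} (`exists_eq_exp_pairing`). Dividing u_x e(0) by it leaves an
exponential cocycle ω. Differentiating the law along tv at t = 0 shows that the one-particle
component h of ω is an additive cocycle.

It remains to see that ω_x = e(h_x). Both sides are exponential cocycles with the same vacuum and
one-particle components, so it is enough that these components determine the cocycle
(`IsExponentialCocycle.eq_of_oneParticle`). Cut x into n equal steps s and exchange one cocycle for
the other step by step. With w = V_{ks}* v, the exchange at step k costs at most a constant times
‖(1 - V_s V_s*) w‖² ‖ω_s - ω'_s‖, because only the part of degree at least two is seen. The squared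
norms are ‖V_{ks}* v‖² - ‖V_{(k+1)s}* v‖², whose sum is at most ‖v‖², while ‖ω_s - ω'_s‖ → 0 by
continuity at 0. -/

noncomputable section

namespace CCR


/-! ### Continuous characters of a cone -/

section Character

open Set MeasureTheory Filter Topology

/-- A continuous multiplicative function on the half line is an exponential. -/
theorem exists_eq_exp_of_map_add_eq_mul (g : ℝ → ℂ) (hg : Continuous g) (h0 : g 0 = 1)
    (hmul : ∀ s t, 0 ≤ s → 0 ≤ t → g (s + t) = g s * g t) :
    ∃ c : ℂ, ∀ t : ℝ, 0 ≤ t → g t = Complex.exp (t * c) := by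
  set I : ℝ → ℂ := fun t => ∫ x in (0 : ℝ)..t, g x with hI
  have hId : ∀ t, HasDerivAt I (g t) t := fun t =>
    (hg.integral_hasStrictDerivAt 0 t).hasDerivAt
  -- If the primitive vanished on the half line, its right derivative at 0, which is g 0 = 1, would
  -- vanish.
  obtain ⟨δ, hδ, hIδ⟩ : ∃ δ : ℝ, 0 ≤ δ ∧ I δ ≠ 0 := by
    by_contra! h
    have h1 : HasDerivWithinAt I 0 (Ici 0) 0 :=
      (hasDerivWithinAt_const (0 : ℝ) (Ici 0) (0 : ℂ)).congr (fun t ht => h t ht) (h 0 le_rfl)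
    have h2 := (uniqueDiffWithinAt_Ici (0 : ℝ)).eq_deriv _ h1 (hId 0).hasDerivWithinAt
    rw [h0] at h2
    exact zero_ne_one h2
  -- Integrating g(t + x) = g(t) g(x) over x ∈ [0, δ] expresses g through its primitive, so g
  -- inherits differentiability. The formula is available only for t ≥ 0, hence the right
  -- derivatives below.
  have hgI : ∀ t, 0 ≤ t → g t = (I (t + δ) - I t) / I δ := by
    intro t ht
    rw [eq_div_iff hIδ, hI]
    simp only
    rw [intervalIntegral.integral_interval_sub_left (hg.intervalIntegrable _ _)
      (hg.intervalIntegrable _ _), ← intervalIntegral.integral_const_mul]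
    have : ∫ x in t..t + δ, g x = ∫ x in (0 : ℝ)..δ, g (t + x) := by
      rw [intervalIntegral.integral_comp_add_left, add_zero]
    rw [this]
    refine intervalIntegral.integral_congr fun x hx => ?_
    rw [uIcc_of_le hδ] at hx
    exact (hmul t x ht hx.1).symm
  set c : ℂ := (g δ - 1) / I δ with hc
  have hgd : ∀ t, 0 ≤ t → HasDerivWithinAt g (g t * c) (Ici t) t := by
    intro t ht
    have h1 : HasDerivAt (fun s => (I (s + δ) - I s) / I δ) ((g (t + δ) - g t) / I δ) t :=
      (((hId (t + δ)).comp_add_const t δ).sub (hId t)).div_const _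
    rw [show (g (t + δ) - g t) / I δ = g t * c by rw [hmul t δ ht hδ, hc]; ring] at h1
    exact h1.hasDerivWithinAt.congr (fun s hs => hgI s (ht.trans hs)) (hgI t ht)
  refine ⟨c, fun t ht => ?_⟩
  have hcst := constant_of_has_deriv_right_zero (f := fun s : ℝ => g s * Complex.exp (-(s * c)))
    (a := 0) (b := t) (by fun_prop) (by
      intro s hs
      have h1 : HasDerivAt (fun s : ℝ => Complex.exp (-(s * c)))
          (Complex.exp (-(s * c)) * -(1 * c)) s :=
        ((Complex.ofRealCLM.hasDerivAt (x := s)).mul_const c).neg.cexp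
      refine ((hgd s hs.1).mul h1.hasDerivWithinAt).congr_deriv ?_
      ring) t ⟨ht, le_rfl⟩
  simp only [h0, Complex.ofReal_zero, zero_mul, neg_zero, Complex.exp_zero, mul_one] at hcst
  rw [← mul_one (g t), ← Complex.exp_zero, ← neg_add_cancel ((t : ℂ) * c), Complex.exp_add,
    ← mul_assoc, hcst, one_mul]

/-- The exponents are the right derivatives at t = 0. A single value of t would fix them only modulo
2πi/t. -/
theorem eq_of_exp_mul_eq {a b : ℂ}
    (h : ∀ t : ℝ, 0 ≤ t → Complex.exp (t * a) = Complex.exp (t * b)) : a = b := by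
  have hd : ∀ z : ℂ, HasDerivWithinAt (fun t : ℝ => Complex.exp (t * z)) z (Ici 0) 0 := by
    intro z
    have := ((Complex.ofRealCLM.hasDerivAt (x := 0)).mul_const z).cexp
    simpa using this.hasDerivWithinAt
  exact (uniqueDiffWithinAt_Ici (0 : ℝ)).eq_deriv _ (hd a)
    ((hd b).congr (fun t ht => h t ht) (h 0 le_rfl))

/-! ### Linear functionals and exponentials on a spanning cone. -/

variable {d : ℕ} {P : PointedCone ℝ (EuclideanSpace ℝ (Fin d))}

theorem continuous_smul_cone (x : P) :
    Continuous fun t : {t : ℝ // 0 ≤ t} => t • x :=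
  Continuous.subtype_mk (f := fun t : {t : ℝ // 0 ≤ t} =>
    (t : ℝ) • (x : EuclideanSpace ℝ (Fin d))) (by fun_prop) _

/-- The linear functional `⟨x, μ⟩ = ∑ i, x_i μ_i`. -/
def pairing (μ : Fin d → ℂ) : EuclideanSpace ℝ (Fin d) →ₗ[ℝ] ℂ where
  toFun x := ∑ i, (x i : ℂ) * μ i
  map_add' x y := by simp [add_mul, Finset.sum_add_distrib]
  map_smul' c x := by simp [Finset.mul_sum, mul_assoc]

theorem pairing_apply (μ : Fin d → ℂ) (x : EuclideanSpace ℝ (Fin d)) :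
    pairing μ x = ∑ i, (x i : ℂ) * μ i := rfl

theorem exists_pairing_eq (L : EuclideanSpace ℝ (Fin d) →ₗ[ℝ] ℂ) :
    ∃ μ : Fin d → ℂ, pairing μ = L := by
  refine ⟨fun i => L (EuclideanSpace.single i 1), ?_⟩
  refine (EuclideanSpace.basisFun (Fin d) ℝ).toBasis.ext fun i => ?_
  simp [pairing_apply, apply_ite Complex.ofReal]

theorem pairing_injective : Function.Injective (pairing (d := d)) := by
  intro μ ν h
  funext i
  simpa [pairing_apply, Pi.single_apply, apply_ite Complex.ofReal] using
    LinearMap.congr_fun h (EuclideanSpace.single i (1 : ℝ))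

/-- A function on a spanning cone which is additive and positively homogeneous extends to a linear
functional. -/
theorem exists_linearMap_of_additive
    (hP : ∀ z : EuclideanSpace ℝ (Fin d), ∃ x ∈ P, ∃ y ∈ P, z = x - y) (l : P → ℂ)
    (hadd : ∀ x y, l (x + y) = l x + l y)
    (hsmul : ∀ (t : {t : ℝ // 0 ≤ t}) x, l (t • x) = ((t : ℝ) : ℂ) * l x) :
    ∃ L : EuclideanSpace ℝ (Fin d) →ₗ[ℝ] ℂ, ∀ x : P, L x = l x := by
  have hP' : ∀ z : EuclideanSpace ℝ (Fin d), ∃ p : P × P, z = p.1 - p.2 := fun z => by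
    obtain ⟨x, hx, y, hy, h⟩ := hP z
    exact ⟨(⟨x, hx⟩, ⟨y, hy⟩), h⟩
  choose p hp using hP'
  -- The value l x - l y does not depend on the representation z = x - y. Everything below follows
  -- by picking a convenient one.
  have key : ∀ (z : EuclideanSpace ℝ (Fin d)) (x y : P), z = x - y →
      l (p z).1 - l (p z).2 = l x - l y := by
    intro z x y h
    have h1 : (p z).1 + y = x + (p z).2 := by
      refine Subtype.ext ?_
      rw [hp z] at h
      push_cast
      rw [sub_eq_sub_iff_add_eq_add] at h
      exact h
    have h2 := congrArg l h1
    rw [hadd, hadd] at h2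
    linear_combination h2
  have hsub : ∀ z w, l (p (z - w)).1 - l (p (z - w)).2 =
      (l (p z).1 - l (p z).2) - (l (p w).1 - l (p w).2) := by
    intro z w
    rw [key (z - w) ((p z).1 + (p w).2) ((p z).2 + (p w).1) (by
      push_cast
      nth_rewrite 1 [hp z, hp w]
      abel), hadd, hadd]
    ring
  have hpos : ∀ (t : {t : ℝ // 0 ≤ t}) z, l (p ((t : ℝ) • z)).1 - l (p ((t : ℝ) • z)).2 =
      ((t : ℝ) : ℂ) * (l (p z).1 - l (p z).2) := by
    intro t z
    rw [key ((t : ℝ) • z) (t • (p z).1) (t • (p z).2) (by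
      nth_rewrite 1 [hp z]
      rw [smul_sub]
      rfl), hsmul, hsmul]
    ring
  have hzero : l (p 0).1 - l (p 0).2 = 0 := by simpa using hsub 0 0
  refine ⟨{ toFun := fun z => l (p z).1 - l (p z).2, map_add' := ?_, map_smul' := ?_ }, ?_⟩
  · intro z w
    have h1 := hsub z (0 - w)
    rw [hsub 0 w, hzero] at h1
    rw [show z - (0 - w) = z + w by abel] at h1
    rw [h1]
    ring
  · intro c z
    rw [RingHom.id_apply, Complex.real_smul]
    rcases le_total 0 c with hc | hc
    · exact hpos ⟨c, hc⟩ z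
    · have h1 := hpos ⟨-c, neg_nonneg.2 hc⟩ z
      have h2 := hsub 0 ((-c) • z)
      rw [h1, hzero] at h2
      simp only [neg_smul, sub_neg_eq_add, zero_add] at h2
      rw [h2]
      push_cast
      ring
  · intro x
    have h0 : l 0 = 0 := by simpa using hadd 0 0
    exact (key x x 0 (by simp)).trans (by rw [h0, sub_zero])

/-- A continuous multiplicative function on a spanning cone is an exponential. -/
theorem exists_eq_exp_pairing
    (hP : ∀ z : EuclideanSpace ℝ (Fin d), ∃ x ∈ P, ∃ y ∈ P, z = x - y) (f : P → ℂ)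
    (hf : Continuous f) (h0 : f 0 = 1) (hmul : ∀ x y, f (x + y) = f x * f y) :
    ∃ μ : Fin d → ℂ, ∀ x : P, f x = Complex.exp (pairing μ x) := by
  -- Each ray carries its own exponent. By uniqueness of exponents these depend on x additively and
  -- homogeneously, so no branch of the logarithm has to be chosen. The `max t 0` only extends the
  -- function to the whole line.
  have h1 : ∀ x : P, ∃ c : ℂ, ∀ t : {t : ℝ // 0 ≤ t},
      f (t • x) = Complex.exp ((t : ℝ) * c) := by
    intro x
    obtain ⟨c, hc⟩ := exists_eq_exp_of_map_add_eq_mul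
      (fun t => f ((⟨max t 0, le_max_right _ _⟩ : {t : ℝ // 0 ≤ t}) • x))
      (hf.comp ((continuous_smul_cone x).comp
        (Continuous.subtype_mk (by fun_prop) _)))
      (by
        rw [← h0]
        refine congrArg f (Subtype.ext ?_)
        change (max (0 : ℝ) 0) • (x : EuclideanSpace ℝ (Fin d)) = 0
        simp)
      (by
        intro s t hs ht
        rw [← hmul]
        refine congrArg f (Subtype.ext ?_)
        change (max (s + t) 0) • (x : EuclideanSpace ℝ (Fin d)) = max s 0 • (x : _) + max t 0 • (x : _)
        rw [max_eq_left hs, max_eq_left ht, max_eq_left (add_nonneg hs ht), add_smul])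
    refine ⟨c, fun t => ?_⟩
    rw [← hc t t.2]
    refine congrArg f (Subtype.ext ?_)
    change (t : ℝ) • (x : EuclideanSpace ℝ (Fin d)) = max (t : ℝ) 0 • (x : _)
    rw [max_eq_left t.2]
  choose l hl using h1
  obtain ⟨L, hL⟩ := exists_linearMap_of_additive hP l
    (fun x y => eq_of_exp_mul_eq fun t ht => by
      rw [← hl (x + y) ⟨t, ht⟩, smul_add, hmul, hl, hl, ← Complex.exp_add, mul_add])
    (fun s x => eq_of_exp_mul_eq fun t ht => by
      have h2 := hl x (⟨t, ht⟩ * s)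
      have h3 : ((⟨t, ht⟩ : {t : ℝ // 0 ≤ t}) * s) • x = (⟨t, ht⟩ : {t : ℝ // 0 ≤ t}) • s • x :=
        Subtype.ext (mul_smul t (s : ℝ) (x : EuclideanSpace ℝ (Fin d)))
      rw [h3, hl (s • x) ⟨t, ht⟩] at h2
      rw [h2]
      congr 1
      change ((t * (s : ℝ) : ℝ) : ℂ) * l x = _
      push_cast
      ring)
  obtain ⟨μ, rfl⟩ := exists_pairing_eq L
  refine ⟨μ, fun x => ?_⟩
  have h3 := hl x 1
  rw [one_smul] at h3
  rw [hL, h3]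
  congr 1
  change ((1 : ℝ) : ℂ) * l x = _
  simp

theorem eq_of_exp_pairing_eq
    (hP : ∀ z : EuclideanSpace ℝ (Fin d), ∃ x ∈ P, ∃ y ∈ P, z = x - y) {μ ν : Fin d → ℂ}
    (h : ∀ x : P, Complex.exp (pairing μ x) = Complex.exp (pairing ν x)) : μ = ν := by
  have h1 : ∀ x ∈ P, pairing μ x = pairing ν x := fun x hx =>
    eq_of_exp_mul_eq fun t ht => by
      have h2 := h ((⟨t, ht⟩ : {t : ℝ // 0 ≤ t}) • ⟨x, hx⟩)
      change Complex.exp (pairing μ (t • x)) = Complex.exp (pairing ν (t • x)) at h2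
      rwa [map_smul, map_smul, Complex.real_smul, Complex.real_smul] at h2
  refine pairing_injective (LinearMap.ext fun z => ?_)
  obtain ⟨x, hx, y, hy, rfl⟩ := hP z
  rw [map_sub, map_sub, h1 x hx, h1 y hy]

end Character


/-! ### Exponential vectors and the one-particle space -/

section FockLemmas

open Filter Topology

variable {K : Type u} [NormedAddCommGroup K] [InnerProductSpace ℂ K]

theorem symPow_one_add (v w : K) : symPow 1 (v + w) = symPow 1 v + symPow 1 w := by
  refine Subtype.ext ?_
  change ((pureTensor K 1 (fun _ => v + w) : AlgTensorPower K 1) : TensorPower K 1) =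
    ((pureTensor K 1 (fun _ => v) : AlgTensorPower K 1) : TensorPower K 1) +
    ((pureTensor K 1 (fun _ => w) : AlgTensorPower K 1) : TensorPower K 1)
  rw [← UniformSpace.Completion.coe_add]
  exact congrArg _ (TensorProduct.add_tmul v w _)

theorem symPow_one_smul (c : ℂ) (v : K) : symPow 1 (c • v) = c • symPow 1 v := by
  refine Subtype.ext ?_
  change ((pureTensor K 1 (fun _ => c • v) : AlgTensorPower K 1) : TensorPower K 1) =
    c • ((pureTensor K 1 (fun _ => v) : AlgTensorPower K 1) : TensorPower K 1)
  rw [← UniformSpace.Completion.coe_smul]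
  exact congrArg _ (TensorProduct.smul_tmul' c v _).symm

/-- The embedding of `K` into `Γ(K)` as the one-particle space, as a linear isometry. -/
def oneParticleIsometry : K →ₗᵢ[ℂ] Fock K :=
  LinearMap.isometryOfInner
    ({ toFun := fun v => lp.single 2 1 (symPow 1 v)
       map_add' := fun v w => by rw [symPow_one_add, lp.single_add]
       map_smul' := fun c v => by rw [symPow_one_smul, lp.single_smul]; rfl } :
      K →ₗ[ℂ] Fock K)
    (fun v w => by
      change ⟪(lp.single 2 1 (symPow 1 v) : Fock K), lp.single 2 1 (symPow 1 w)⟫_ℂ = _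
      rw [lp.inner_single_right, lp.single_apply_self, inner_symPow, pow_one])

/-- The embedding of `K` into `Γ(K)` as the one-particle space. -/
def oneParticle : K →L[ℂ] Fock K := oneParticleIsometry.toContinuousLinearMap

theorem oneParticle_apply (v : K) : (oneParticle v : Fock K) = lp.single 2 1 (symPow 1 v) := rfl

theorem inner_oneParticle (v w : K) : ⟪oneParticle v, oneParticle w⟫_ℂ = ⟪v, w⟫_ℂ :=
  oneParticleIsometry.inner_map_map v w

theorem inner_expVec_oneParticle (v w : K) : ⟪expVec v, oneParticle w⟫_ℂ = ⟪v, w⟫_ℂ := by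
  rw [oneParticle_apply, lp.inner_single_right]
  change ⟪((Real.sqrt (1 ! : ℝ) : ℂ))⁻¹ • symPow 1 v, symPow 1 w⟫_ℂ = _
  refine (inner_smul_left (𝕜 := ℂ) (symPow 1 v) _ _).trans ?_
  rw [inner_symPow]
  simp

theorem inner_oneParticle_expVec (v w : K) : ⟪oneParticle v, expVec w⟫_ℂ = ⟪v, w⟫_ℂ := by
  rw [← inner_conj_symm, inner_expVec_oneParticle, inner_conj_symm]

theorem norm_expVec_sq (v : K) : ‖expVec v‖ ^ 2 = Real.exp (‖v‖ ^ 2) := by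
  rw [@norm_sq_eq_re_inner ℂ, inner_expVec, inner_self_eq_norm_sq_to_K]
  have : ((‖v‖ : ℂ)) ^ 2 = ((‖v‖ ^ 2 : ℝ) : ℂ) := by push_cast; rfl
  change (Complex.exp ((‖v‖ : ℂ) ^ 2)).re = _
  rw [this, Complex.exp_ofReal_re]

theorem norm_expVec_coe (S : Submodule ℂ K) (k : S) : ‖expVec k‖ = ‖expVec (k : K)‖ := by
  refine (pow_left_inj₀ (norm_nonneg _) (norm_nonneg _) two_ne_zero).1 ?_
  rw [norm_expVec_sq, norm_expVec_sq, Submodule.coe_norm]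

theorem norm_expVec_le_of_norm_le {v w : K} (h : ‖v‖ ≤ ‖w‖) : ‖expVec v‖ ≤ ‖expVec w‖ := by
  refine (pow_le_pow_iff_left₀ (norm_nonneg _) (norm_nonneg _) two_ne_zero).1 ?_
  rw [norm_expVec_sq, norm_expVec_sq]
  gcongr

theorem inner_self_expVec_sub (v w : K) : ‖expVec v - expVec w‖ ^ 2 =
    Real.exp (‖v‖ ^ 2) - 2 * (Complex.exp ⟪v, w⟫_ℂ).re + Real.exp (‖w‖ ^ 2) := by
  rw [@norm_sub_sq ℂ, norm_expVec_sq, norm_expVec_sq, inner_expVec]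
  rfl

/-- The squared distance is a continuous expression in norms and inner products that vanishes at v =
w. -/
theorem continuous_expVec : Continuous (expVec : K → Fock K) := by
  refine continuous_iff_continuousAt.2 fun w => ?_
  rw [ContinuousAt, tendsto_iff_norm_sub_tendsto_zero]
  have h1 : Tendsto (fun v => ‖expVec v - expVec w‖ ^ 2) (𝓝 w) (𝓝 0) := by
    simp only [inner_self_expVec_sub]
    have h2 : Continuous fun v : K =>
        Real.exp (‖v‖ ^ 2) - 2 * (Complex.exp ⟪v, w⟫_ℂ).re + Real.exp (‖w‖ ^ 2) := by fun_prop
    convert h2.tendsto w using 2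
    have h3 := congrArg Complex.re (inner_self_eq_norm_sq_to_K (𝕜 := ℂ) (expVec w))
    rw [inner_expVec] at h3
    have h4 : (((‖expVec w‖ : ℂ)) ^ 2).re = ‖expVec w‖ ^ 2 := by
      rw [← Complex.ofReal_pow, Complex.ofReal_re]
    rw [h3.trans h4, norm_expVec_sq]
    ring
  have h3 := h1.sqrt
  simpa using h3

/-- The part of an exponential vector of degree at least two is of second order. -/
theorem norm_expVec_sub_sub_le (p : K) :
    ‖expVec p - expVec 0 - oneParticle p‖ ≤ ‖p‖ ^ 2 * ‖expVec p‖ := by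
  refine (pow_le_pow_iff_left₀ (norm_nonneg _) (by positivity) two_ne_zero).1 ?_
  have h1 : ((‖expVec p - expVec 0 - oneParticle p‖ ^ 2 : ℝ) : ℂ) =
      ((Real.exp (‖p‖ ^ 2) - 1 - ‖p‖ ^ 2 : ℝ) : ℂ) := by
    have h2 : ((‖p‖ : ℂ)) ^ 2 = ⟪p, p⟫_ℂ := (inner_self_eq_norm_sq_to_K (𝕜 := ℂ) p).symm
    have h3 := inner_self_eq_norm_sq_to_K (𝕜 := ℂ) (expVec p - expVec 0 - oneParticle p)
    push_cast
    refine h3.symm.trans ?_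
    rw [h2]
    simp only [inner_sub_left, inner_sub_right, inner_expVec, inner_oneParticle,
      inner_expVec_oneParticle, inner_oneParticle_expVec, inner_zero_left, inner_zero_right,
      Complex.exp_zero]
    ring
  have h4 : ‖expVec p - expVec 0 - oneParticle p‖ ^ 2 = Real.exp (‖p‖ ^ 2) - 1 - ‖p‖ ^ 2 := by
    exact_mod_cast h1
  rw [h4, mul_pow, norm_expVec_sq]
  set r := ‖p‖ ^ 2
  have hr : 0 ≤ r := by positivity
  -- `1 - r ≤ e^{-r}` gives `e^r - 1 ≤ r e^r`
  have h5 : Real.exp r - 1 ≤ r * Real.exp r := by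
    have h6 := mul_le_mul_of_nonneg_right (Real.add_one_le_exp (-r)) (Real.exp_pos r).le
    rw [← Real.exp_add, neg_add_cancel, Real.exp_zero] at h6
    linarith
  -- The bound is used twice: e^r - 1 - r ≤ r (e^r - 1) ≤ r² e^r.
  have h7 := mul_le_mul_of_nonneg_left h5 hr
  nlinarith [Real.add_one_le_exp r]

/-- The remainder is O(t²), with a uniform constant because ‖e(tv)‖ ≤ ‖e(v)‖ for |t| ≤ 1. -/
theorem hasDerivAt_expVec_smul (v : K) :
    HasDerivAt (fun t : ℝ => expVec ((t : ℂ) • v)) (oneParticle v) 0 := by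
  rw [hasDerivAt_iff_isLittleO_nhds_zero]
  refine Asymptotics.IsBigO.trans_isLittleO (g := fun t : ℝ => t ^ 2) ?_
    (Asymptotics.isLittleO_pow_id one_lt_two)
  refine Asymptotics.IsBigO.of_bound (‖v‖ ^ 2 * ‖expVec v‖) ?_
  filter_upwards [Metric.ball_mem_nhds (0 : ℝ) one_pos] with t ht
  have h1 := norm_expVec_sub_sub_le ((t : ℂ) • v)
  have h2 : ‖(t : ℂ) • v‖ = |t| * ‖v‖ := by rw [norm_smul, Complex.norm_real, Real.norm_eq_abs]
  have h3 : |t| ≤ 1 := by simpa using (mem_ball_zero_iff.1 ht).le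
  have h4 : ‖expVec ((t : ℂ) • v)‖ ≤ ‖expVec v‖ := norm_expVec_le_of_norm_le (by
    rw [h2]
    exact mul_le_of_le_one_left (norm_nonneg _) h3)
  rw [map_smul, h2, mul_pow, sq_abs] at h1
  have h5 : ((t : ℂ) • oneParticle v : Fock K) = t • oneParticle v := rfl
  rw [h5] at h1
  simp only [zero_add, Complex.ofReal_zero, zero_smul]
  rw [norm_pow, Real.norm_eq_abs, sq_abs]
  refine h1.trans ?_
  nlinarith [mul_le_mul_of_nonneg_left h4 (show 0 ≤ t ^ 2 * ‖v‖ ^ 2 by positivity)]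

end FockLemmas


/-! ### Intertwiners of ampliations -/

section Intertwiner

variable {X Y : Type u} [NormedAddCommGroup X] [InnerProductSpace ℂ X]
  [NormedAddCommGroup Y] [InnerProductSpace ℂ Y]

theorem eq_of_inner_total {ι : Type*} (a : ι → X)
    (ha : (Submodule.span ℂ (Set.range a)).topologicalClosure = ⊤) {ξ η : X}
    (h : ∀ i, ⟪a i, ξ⟫_ℂ = ⟪a i, η⟫_ℂ) : ξ = η := by
  have hd := Submodule.dense_iff_topologicalClosure_eq_top.2 ha
  refine hd.eq_of_inner_right ℂ fun x hx => ?_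
  induction hx using Submodule.span_induction with
  | mem x hx => obtain ⟨i, rfl⟩ := hx; exact h i
  | zero => simp
  | add x y _ _ hx hy => rw [inner_add_left, inner_add_left, hx, hy]
  | smul c x _ hx => rw [inner_smul_left, inner_smul_left, hx]

theorem clm_ext_total {ι H : Type*} [NormedAddCommGroup H] [NormedSpace ℂ H] (a : ι → X)
    (ha : (Submodule.span ℂ (Set.range a)).topologicalClosure = ⊤)
    {A B : X →L[ℂ] H} (h : ∀ i, A (a i) = B (a i)) : A = B := by
  refine ContinuousLinearMap.ext_on (Submodule.dense_iff_topologicalClosure_eq_top.2 ha) ?_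
  rintro _ ⟨i, rfl⟩
  exact h i

/-- The operator `W` satisfies `W* W = 1`. -/
def AdjointLeftInverse [CompleteSpace X] [CompleteSpace Y] (W : X →L[ℂ] Y) : Prop :=
  ∀ z, W.adjoint (W z) = z

/-- The bounded operator `x ↦ x ⊗ y` into the Hilbert space tensor product. -/
def tensorRight (y : Y) : X →L[ℂ] HilbertTensor X Y :=
  (UniformSpace.Completion.toComplL (𝕜 := ℂ) (E := X ⊗[ℂ] Y)) ∘L
    ((TensorProduct.mkL ℂ X Y).flip y)

theorem tensorRight_apply (x : X) (y : Y) : tensorRight y x = tensorLeft x y := rfl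

theorem tensorLeft_smul (c : ℂ) (x : X) (y : Y) : tensorLeft (c • x) y = c • tensorLeft x y := by
  rw [← tensorRight_apply, map_smul, tensorRight_apply]

theorem span_tensorLeft_univ :
    (Submodule.span ℂ (Set.range fun p : X × Y =>
      (tensorLeft p.1 p.2 : HilbertTensor X Y))).topologicalClosure = ⊤ := by
  refine span_tensorLeft (fun x : X => x) (fun y : Y => y) ?_ ?_ <;>
  · rw [Set.range_id', Submodule.span_univ, eq_top_iff]
    exact Submodule.le_topologicalClosure _

theorem ampliation_id (z : HilbertTensor X Y) :
    ampliation X (ContinuousLinearMap.id ℂ Y) z = z := by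
  have h : ampliation X (ContinuousLinearMap.id ℂ Y) = ContinuousLinearMap.id ℂ _ := by
    refine clm_ext_total _ span_tensorLeft_univ ?_
    rintro ⟨x, w⟩
    rw [ampliation_tensorLeft]
    rfl
  rw [h]
  rfl

theorem inner_map_tensorLeft [CompleteSpace Y] (W : HilbertTensor X Y →L[ℂ] Y)
    (hW : AdjointLeftInverse W) (x ξ : X) (y η : Y) :
    ⟪W (tensorLeft x y), W (tensorLeft ξ η)⟫_ℂ = ⟪x, ξ⟫_ℂ * ⟪y, η⟫_ℂ := by
  rw [← ContinuousLinearMap.adjoint_inner_right, hW, inner_tensorLeft]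

theorem ampliation_flow_comp [CompleteSpace Y] (W : HilbertTensor X Y →L[ℂ] Y)
    (hW : AdjointLeftInverse W) (ξ : X) (T : Y →L[ℂ] Y) :
    (W ∘L ampliation X T ∘L W.adjoint) ∘L (W ∘L tensorLeft ξ) = (W ∘L tensorLeft ξ) ∘L T := by
  ext1 η
  simp only [ContinuousLinearMap.comp_apply]
  rw [hW, ampliation_tensorLeft]

variable [CompleteSpace X]

theorem tensorRight_adjoint_tensorLeft (e : Y) (x : X) (y : Y) :
    (tensorRight (X := X) e).adjoint (tensorLeft x y) = ⟪e, y⟫_ℂ • x := by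
  refine ext_inner_left ℂ fun z => ?_
  rw [ContinuousLinearMap.adjoint_inner_right, tensorRight_apply, inner_tensorLeft,
    inner_smul_right, mul_comm]

/-- The operator 1 ⊗ |y⟩⟨e| slices by e in the second factor and then tensors with y; both sides
agree on elementary tensors. -/
theorem ampliation_rankOne (e y : Y) (z : HilbertTensor X Y) :
    ampliation X (InnerProductSpace.rankOne ℂ y e) z =
      tensorLeft ((tensorRight e).adjoint z) y := by
  have h : ampliation X (InnerProductSpace.rankOne ℂ y e) =
      tensorRight y ∘L (tensorRight e).adjoint := by
    refine clm_ext_total _ span_tensorLeft_univ ?_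
    rintro ⟨x, w⟩
    rw [ampliation_tensorLeft, ContinuousLinearMap.comp_apply, tensorRight_adjoint_tensorLeft,
      tensorRight_apply, InnerProductSpace.rankOne_apply, tensorLeft_smul, map_smul]
  rw [h]
  rfl

/-- The operators `A : Y → X ⊗ Y` with `(1 ⊗ T) A = A T` for all `T` are the `y ↦ ξ ⊗ y`. -/
theorem exists_eq_tensorLeft (A : Y →L[ℂ] HilbertTensor X Y)
    (hA : ∀ (T : Y →L[ℂ] Y) y, ampliation X T (A y) = A (T y)) {e : Y} (he : ⟪e, e⟫_ℂ = 1) :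
    ∃ ξ : X, ∀ y, A y = tensorLeft ξ y := by
  -- Since y = |y⟩⟨e| e, the intertwining relation gives A y = (1 ⊗ |y⟩⟨e|) A e, which is the slice
  -- of A e by e, tensored with y.
  refine ⟨(tensorRight e).adjoint (A e), fun y => ?_⟩
  rw [← ampliation_rankOne, hA, InnerProductSpace.rankOne_apply, he, one_smul]

variable [CompleteSpace Y]

theorem exists_eq_comp_tensorLeft (W : HilbertTensor X Y →L[ℂ] Y)
    (hW : AdjointLeftInverse W) {e : Y} (he : ⟪e, e⟫_ℂ = 1) (u : Y →L[ℂ] Y)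
    (hu : ∀ T, (W ∘L ampliation X T ∘L W.adjoint) ∘L u = u ∘L T) :
    ∃ ξ : X, u = W ∘L tensorLeft ξ := by
  have h1 : ∀ (T : Y →L[ℂ] Y) η, W (ampliation X T (W.adjoint (u η))) = u (T η) := fun T η =>
    congrArg (fun A => A η) (hu T)
  obtain ⟨ξ, hξ⟩ := exists_eq_tensorLeft (W.adjoint ∘L u) (fun T η => by
    rw [ContinuousLinearMap.comp_apply, ContinuousLinearMap.comp_apply, ← h1 T η, hW]) he
  refine ⟨ξ, ContinuousLinearMap.ext fun η => ?_⟩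
  -- Taking T = 1 gives u = W W* u, so u has its range in that of W and surjectivity of W is not
  -- needed.
  have h2 := h1 (ContinuousLinearMap.id ℂ _) η
  rw [ampliation_id] at h2
  rw [ContinuousLinearMap.comp_apply, ← hξ η]
  exact h2.symm

theorem adjointLeftInverse_extendTotal {ι : Type*} (a : ι → X) (b : ι → Y)
    (ha : (Submodule.span ℂ (Set.range a)).topologicalClosure = ⊤)
    (hab : ∀ i j, ⟪b i, b j⟫_ℂ = ⟪a i, a j⟫_ℂ) : AdjointLeftInverse (extendTotal a b) := by
  have h : (extendTotal a b).adjoint ∘L extendTotal a b = ContinuousLinearMap.id ℂ X := by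
    refine clm_ext_total a ha fun i => eq_of_inner_total a ha fun j => ?_
    rw [ContinuousLinearMap.comp_apply, ContinuousLinearMap.adjoint_inner_right,
      extendTotal_apply a b ha hab, extendTotal_apply a b ha hab, hab, ContinuousLinearMap.id_apply]
  exact fun z => congrArg (fun A => A z) h

end Intertwiner

/-! ### Operators intertwining the CCR flow -/

section Creation

variable {K : Type u} [NormedAddCommGroup K] [InnerProductSpace ℂ K] [CompleteSpace K]

theorem eq_of_inner_expVec {ξ η : Fock K}
    (h : ∀ v : K, ⟪expVec v, ξ⟫_ℂ = ⟪expVec v, η⟫_ℂ) : ξ = η :=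
  eq_of_inner_total _ span_expVec h

theorem clm_ext_expVec {H : Type*} [NormedAddCommGroup H] [NormedSpace ℂ H]
    {A B : Fock K →L[ℂ] H} (h : ∀ v, A (expVec v) = B (expVec v)) : A = B :=
  clm_ext_total _ span_expVec h

theorem adjoint_apply_of_isometry {v : K →L[ℂ] K} (hv : ∀ ξ, ‖v ξ‖ = ‖ξ‖) (ξ : K) :
    v.adjoint (v ξ) = ξ := by
  refine ext_inner_left ℂ fun z => ?_
  rw [ContinuousLinearMap.adjoint_inner_right]
  exact LinearIsometry.inner_map_map ⟨v.toLinearMap, hv⟩ z ξ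

/-- The projection `1 - v v*`. -/
def kerProj (v : K →L[ℂ] K) (ξ : K) : K := ξ - v (v.adjoint ξ)

theorem kerProj_add (v : K →L[ℂ] K) (ξ : K) : kerProj v ξ + v (v.adjoint ξ) = ξ :=
  sub_add_cancel _ _

theorem adjoint_kerProj {v : K →L[ℂ] K} (hv : ∀ ξ, ‖v ξ‖ = ‖ξ‖) (ξ : K) :
    v.adjoint (kerProj v ξ) = 0 := by
  rw [kerProj, map_sub, adjoint_apply_of_isometry hv, sub_self]

theorem kerProj_eq_self {v : K →L[ℂ] K} {ξ : K} (h : v.adjoint ξ = 0) : kerProj v ξ = ξ := by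
  rw [kerProj, h, map_zero, sub_zero]

theorem inner_kerProj_left (v : K →L[ℂ] K) (ξ η : K) :
    ⟪kerProj v ξ, η⟫_ℂ = ⟪ξ, kerProj v η⟫_ℂ := by
  rw [kerProj, kerProj, inner_sub_left, inner_sub_right, ← ContinuousLinearMap.adjoint_inner_left v,
    ← ContinuousLinearMap.adjoint_inner_right v]

/-- Pythagoras for the splitting along ker v* and the range of v. In this form the squared norms
telescope along a subdivision. -/
theorem norm_kerProj_sq {v : K →L[ℂ] K} (hv : ∀ ξ, ‖v ξ‖ = ‖ξ‖) (ξ : K) :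
    ‖kerProj v ξ‖ ^ 2 = ‖ξ‖ ^ 2 - ‖v.adjoint ξ‖ ^ 2 := by
  have h : ⟪kerProj v ξ, v (v.adjoint ξ)⟫_ℂ = 0 := by
    rw [← ContinuousLinearMap.adjoint_inner_left, adjoint_kerProj hv, inner_zero_left]
  have h1 := norm_add_sq_eq_norm_sq_add_norm_sq_of_inner_eq_zero _ _ h
  rw [kerProj_add, hv] at h1
  linarith

theorem adjointLeftInverse_fockUnitary {v : K →L[ℂ] K} (hv : ∀ ξ, ‖v ξ‖ = ‖ξ‖) :
    AdjointLeftInverse (fockUnitary v) := by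
  refine adjointLeftInverse_extendTotal _ _ (span_tensorLeft _ _ span_expVec span_expVec) ?_
  rintro ⟨k, w⟩ ⟨k', w'⟩
  have h1 : ⟪(k : K), v w'⟫_ℂ = 0 := by
    rw [← ContinuousLinearMap.adjoint_inner_left, show v.adjoint (k : K) = 0 from k.2,
      inner_zero_left]
  have h2 : ⟪v w, (k' : K)⟫_ℂ = 0 := by
    rw [← ContinuousLinearMap.adjoint_inner_right, show v.adjoint (k' : K) = 0 from k'.2,
      inner_zero_right]
  have h3 : ⟪v w, v w'⟫_ℂ = ⟪w, w'⟫_ℂ :=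
    LinearIsometry.inner_map_map ⟨v.toLinearMap, hv⟩ w w'
  rw [inner_tensorLeft, inner_expVec, inner_expVec, inner_expVec, ← Complex.exp_add,
    inner_add_left, inner_add_right, inner_add_right, h1, h2, h3, Submodule.coe_inner, zero_add,
    add_zero]

variable {d : ℕ} {P : PointedCone ℝ (EuclideanSpace ℝ (Fin d))} (V : IsometricRep P K)

theorem creation_expVec (x : P) (k : LinearMap.ker (V x).adjoint.toLinearMap) (w : K) :
    creation V x (expVec k) (expVec w) = expVec ((k : K) + V x w) :=
  fockUnitary_apply (V x) (V.isometry x) k w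

theorem ccrFlow_comp_creation (x : P) (ξ : Fock (LinearMap.ker (V x).adjoint.toLinearMap))
    (T : Fock K →L[ℂ] Fock K) :
    ccrFlow V x T ∘L creation V x ξ = creation V x ξ ∘L T :=
   ampliation_flow_comp (fockUnitary (V x)) (adjointLeftInverse_fockUnitary (V.isometry x)) ξ T

/-- The intertwiners of the CCR flow are the operators `R^ξ`. -/
theorem exists_eq_creation (x : P) (u : Fock K →L[ℂ] Fock K)
    (hu : ∀ T, ccrFlow V x T ∘L u = u ∘L T) : ∃ ξ, u = creation V x ξ := by
  exact exists_eq_comp_tensorLeft (fockUnitary (V x)) (adjointLeftInverse_fockUnitary (V.isometry x))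
    (e := expVec (0 : K)) (by rw [inner_expVec, inner_zero_left, Complex.exp_zero]) u hu

/-- The component of `ξ` in `ker V_x*`. -/
def kerComponent (x : P) (ξ : K) : LinearMap.ker (V x).adjoint.toLinearMap :=
  ⟨kerProj (V x) ξ, adjoint_kerProj (V.isometry x) ξ⟩

/-- Under the exponential identification e(w) is the tensor product of the exponential vectors of
its component in ker V_x* and of V_x* w, so the inner product factorises. -/
theorem inner_expVec_creation (x : P) (ξ : Fock (LinearMap.ker (V x).adjoint.toLinearMap))
    (w : K) (η : Fock K) :
    ⟪expVec w, creation V x ξ η⟫_ℂ =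
      ⟪expVec (kerComponent V x w), ξ⟫_ℂ * ⟪expVec ((V x).adjoint w), η⟫_ℂ := by
  have h : expVec w = fockUnitary (V x)
      (tensorLeft (expVec (kerComponent V x w)) (expVec ((V x).adjoint w))) := by
    rw [fockUnitary_apply _ (V.isometry x)]
    exact congrArg expVec (kerProj_add (V x) w).symm
  rw [h]
  exact inner_map_tensorLeft (fockUnitary (V x)) (adjointLeftInverse_fockUnitary (V.isometry x)) _ _ _ _

theorem inner_expVec_creation_vacuum (x : P)
    (ξ : Fock (LinearMap.ker (V x).adjoint.toLinearMap)) (w : K) :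
    ⟪expVec w, creation V x ξ (expVec 0)⟫_ℂ = ⟪expVec (kerComponent V x w), ξ⟫_ℂ := by
  have h : ⟪expVec ((V x).adjoint w), expVec (0 : K)⟫_ℂ = 1 := by
    rw [inner_expVec, inner_zero_right, Complex.exp_zero]
  exact (inner_expVec_creation V x ξ w (expVec 0)).trans ((congrArg _ h).trans (mul_one _))

/-- This expresses that u e(0) belongs to the copy of Γ(ker V_x*) in Γ(K), without a space that
varies with x. -/
theorem inner_expVec_kerProj_of_intertwines (x : P) (u : Fock K →L[ℂ] Fock K)
    (hu : ∀ T, ccrFlow V x T ∘L u = u ∘L T) (w : K) :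
    ⟪expVec (kerProj (V x) w), u (expVec 0)⟫_ℂ = ⟪expVec w, u (expVec 0)⟫_ℂ := by
  obtain ⟨ξ, rfl⟩ := exists_eq_creation V x u hu
  have h : kerComponent V x (kerProj (V x) w) = kerComponent V x w :=
    Subtype.ext (kerProj_eq_self (adjoint_kerProj (V.isometry x) w))
  exact (inner_expVec_creation_vacuum V x ξ (kerProj (V x) w)).trans
    ((congrArg (fun k => ⟪expVec k, ξ⟫_ℂ) h).trans (inner_expVec_creation_vacuum V x ξ w).symm)

theorem inner_expVec_of_intertwines (x : P) (u : Fock K →L[ℂ] Fock K)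
    (hu : ∀ T, ccrFlow V x T ∘L u = u ∘L T) (w : K) (η : Fock K) :
    ⟪expVec w, u η⟫_ℂ = ⟪expVec w, u (expVec 0)⟫_ℂ * ⟪expVec ((V x).adjoint w), η⟫_ℂ := by
  obtain ⟨ξ, rfl⟩ := exists_eq_creation V x u hu
  exact (inner_expVec_creation V x ξ w η).trans
    (congrArg (· * _) (inner_expVec_creation_vacuum V x ξ w).symm)

end Creation


/-! ### Exponential cocycles -/

section ExponentialCocycle

open Filter Topology

variable {K : Type u} [NormedAddCommGroup K] [InnerProductSpace ℂ K]
  {d : ℕ} {P : PointedCone ℝ (EuclideanSpace ℝ (Fin d))} (V : IsometricRep P K)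

/-- V_0 is idempotent, and an injective idempotent is the identity. -/
theorem IsometricRep.zero_apply (ξ : K) : V 0 ξ = ξ := by
  have h : V 0 (V 0 ξ) = V 0 ξ := by
    rw [← ContinuousLinearMap.comp_apply, ← V.map_add, add_zero]
  have h1 := V.isometry 0 (V 0 ξ - ξ)
  rw [map_sub, h, sub_self, norm_zero] at h1
  exact sub_eq_zero.1 (norm_eq_zero.1 h1.symm)

/-- Uniqueness of this derivative carries identities from exponential vectors to one-particle
vectors. The parameter is real because the inner product is conjugate-linear in v. -/
theorem hasDerivAt_inner_expVec_smul (v : K) (ξ : Fock K) :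
    HasDerivAt (fun t : ℝ => ⟪expVec ((t : ℂ) • v), ξ⟫_ℂ) ⟪oneParticle v, ξ⟫_ℂ 0 := by
  have h := (hasDerivAt_expVec_smul v).inner ℂ (hasDerivAt_const (0 : ℝ) ξ)
  simpa using h

theorem exists_norm_le_on_segment {ω : P → Fock K} (hω : Continuous ω) (x : P) :
    ∃ M, ∀ t : {t : ℝ // 0 ≤ t}, (t : ℝ) ≤ 1 → ‖ω (t • x)‖ ≤ M := by
  have hc : Continuous fun t : ℝ =>
      ω ((⟨max t 0, le_max_right _ _⟩ : {t : ℝ // 0 ≤ t}) • x) :=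
    hω.comp ((continuous_smul_cone x).comp (Continuous.subtype_mk (by fun_prop) _))
  obtain ⟨M, hM⟩ := (isCompact_Icc (a := (0 : ℝ)) (b := 1)).exists_bound_of_continuousOn
    hc.continuousOn
  refine ⟨M, fun t ht => ?_⟩
  have h := hM t ⟨t.2, ht⟩
  have h1 : (⟨max (t : ℝ) 0, le_max_right _ _⟩ : {t : ℝ // 0 ≤ t}) = t :=
    Subtype.ext (max_eq_left t.2)
  rwa [h1] at h

variable [CompleteSpace K]

theorem IsometricRep.adjoint_zero_apply (ξ : K) : (V 0).adjoint ξ = ξ := by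
  simpa only [V.zero_apply] using adjoint_apply_of_isometry (V.isometry 0) ξ

theorem IsometricRep.adjoint_add_apply (x y : P) (ξ : K) :
    (V (x + y)).adjoint ξ = (V y).adjoint ((V x).adjoint ξ) := by
  rw [V.map_add, ContinuousLinearMap.adjoint_comp, ContinuousLinearMap.comp_apply]

theorem kerProj_zero_apply (ξ : K) : kerProj (V 0) ξ = 0 := by
  rw [kerProj, V.adjoint_zero_apply, V.zero_apply, sub_self]

theorem norm_adjoint_le {v : K →L[ℂ] K} (hv : ∀ ξ, ‖v ξ‖ = ‖ξ‖) (ξ : K) :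
    ‖v.adjoint ξ‖ ≤ ‖ξ‖ := by
  have h := norm_kerProj_sq hv ξ
  exact (pow_le_pow_iff_left₀ (norm_nonneg _) (norm_nonneg _) two_ne_zero).1
    (by nlinarith [sq_nonneg ‖kerProj v ξ‖])

theorem norm_kerProj_le {v : K →L[ℂ] K} (hv : ∀ ξ, ‖v ξ‖ = ‖ξ‖) (ξ : K) :
    ‖kerProj v ξ‖ ≤ ‖ξ‖ := by
  have h := norm_kerProj_sq hv ξ
  exact (pow_le_pow_iff_left₀ (norm_nonneg _) (norm_nonneg _) two_ne_zero).1
    (by nlinarith [sq_nonneg ‖v.adjoint ξ‖])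

/-- A continuous family `ω_x ∈ Γ(ker V_x*) ⊆ Γ(K)`, normalised against the vacuum, with
`ω_{x+y} = ω_x ⊗ Γ(V_x) ω_y`. -/
structure IsExponentialCocycle (ω : P → Fock K) : Prop where
  continuous : Continuous ω
  vacuum : ∀ x, ⟪expVec 0, ω x⟫_ℂ = 1
  kerProj : ∀ x v, ⟪expVec (kerProj (V x) v), ω x⟫_ℂ = ⟪expVec v, ω x⟫_ℂ
  map_add : ∀ x y v, ⟪expVec v, ω (x + y)⟫_ℂ =
    ⟪expVec v, ω x⟫_ℂ * ⟪expVec ((V x).adjoint v), ω y⟫_ℂ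

theorem isExponentialCocycle_expVec (h : AdditiveCocycle V) :
    IsExponentialCocycle V fun x => expVec (h.toFun x) where
  continuous := continuous_expVec.comp h.continuous
  vacuum x := by rw [inner_expVec, inner_zero_left, Complex.exp_zero]
  kerProj x v := by
    rw [inner_expVec, inner_expVec, inner_kerProj_left, kerProj_eq_self (h.mem_ker x)]
  map_add x y v := by
    rw [inner_expVec, inner_expVec, inner_expVec, ← Complex.exp_add, h.map_add, inner_add_right,
      ContinuousLinearMap.adjoint_inner_left]

variable {V} {ω ω' : P → Fock K}

theorem IsExponentialCocycle.inner_zero (hω : IsExponentialCocycle V ω) (v : K) :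
    ⟪expVec v, ω 0⟫_ℂ = 1 := by
  rw [← hω.kerProj, kerProj_zero_apply, hω.vacuum]

theorem kerProj_smul (v : K →L[ℂ] K) (c : ℂ) (ξ : K) : kerProj v (c • ξ) = c • kerProj v ξ := by
  rw [kerProj, kerProj, map_smul, map_smul, smul_sub]

/-- The one-particle component of an exponential cocycle is an additive cocycle. -/
def IsExponentialCocycle.additiveCocycle (hω : IsExponentialCocycle V ω) : AdditiveCocycle V where
  toFun x := oneParticle.adjoint (ω x)
  continuous := oneParticle.adjoint.continuous.comp hω.continuous
  mem_ker x := by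
    have h : ∀ v, ⟪oneParticle (CCR.kerProj (V x) v), ω x⟫_ℂ = ⟪oneParticle v, ω x⟫_ℂ := by
      intro v
      refine (hasDerivAt_inner_expVec_smul _ _).unique ?_
      simp_rw [← kerProj_smul, hω.kerProj]
      exact hasDerivAt_inner_expVec_smul v (ω x)
    have h1 : CCR.kerProj (V x) (oneParticle.adjoint (ω x)) = oneParticle.adjoint (ω x) := by
      refine ext_inner_left ℂ fun v => ?_
      rw [← inner_kerProj_left, ContinuousLinearMap.adjoint_inner_right,
        ContinuousLinearMap.adjoint_inner_right, h]
    rw [← h1]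
    exact adjoint_kerProj (V.isometry x) _
  map_add x y := by
    refine ext_inner_left ℂ fun v => ?_
    rw [inner_add_right, ← ContinuousLinearMap.adjoint_inner_left (V x),
      ContinuousLinearMap.adjoint_inner_right, ContinuousLinearMap.adjoint_inner_right,
      ContinuousLinearMap.adjoint_inner_right]
    -- Product rule: at t = 0 both factors equal 1 by the vacuum normalisation, so the
    -- multiplicative law becomes an additive one.
    refine (hasDerivAt_inner_expVec_smul v (ω (x + y))).unique ?_
    simp_rw [hω.map_add, map_smul]
    have h := (hasDerivAt_inner_expVec_smul v (ω x)).fun_mul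
      (hasDerivAt_inner_expVec_smul ((V x).adjoint v) (ω y))
    refine h.congr_deriv ?_
    simp [hω.vacuum]

theorem IsExponentialCocycle.inner_additiveCocycle (hω : IsExponentialCocycle V ω) (x : P)
    (v : K) : ⟪v, hω.additiveCocycle.toFun x⟫_ℂ = ⟪oneParticle v, ω x⟫_ℂ :=
  ContinuousLinearMap.adjoint_inner_right _ _ _

/-- The vector w may be replaced by its projection p to ker V_x*. The components of degree 0 and 1
then cancel, and only the second-order tail of e(p) meets ω x - ω' x. -/
theorem IsExponentialCocycle.norm_inner_sub_le (hω : IsExponentialCocycle V ω)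
    (hω' : IsExponentialCocycle V ω')
    (h1 : ∀ x v, ⟪oneParticle v, ω x⟫_ℂ = ⟪oneParticle v, ω' x⟫_ℂ) (x : P) (w : K) :
    ‖⟪expVec w, ω x⟫_ℂ - ⟪expVec w, ω' x⟫_ℂ‖ ≤
      ‖CCR.kerProj (V x) w‖ ^ 2 * ‖expVec w‖ * ‖ω x - ω' x‖ := by
  set p := CCR.kerProj (V x) w with hp
  have h : ⟪expVec w, ω x⟫_ℂ - ⟪expVec w, ω' x⟫_ℂ =
      ⟪expVec p - expVec 0 - oneParticle p, ω x - ω' x⟫_ℂ := by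
    rw [← hω.kerProj, ← hω'.kerProj, inner_sub_left, inner_sub_left, inner_sub_right,
      inner_sub_right, inner_sub_right, hω.vacuum, hω'.vacuum, h1]
    ring
  rw [h]
  refine (norm_inner_le_norm _ _).trans ?_
  refine mul_le_mul_of_nonneg_right ?_ (norm_nonneg _)
  refine (norm_expVec_sub_sub_le p).trans ?_
  exact mul_le_mul_of_nonneg_left (norm_expVec_le_of_norm_le (norm_kerProj_le (V.isometry x) w))
    (sq_nonneg _)

/-- Replacing `ω` by `ω'` on the first `k` of `k + m` equal steps. -/
theorem IsExponentialCocycle.norm_telescope_le (hω : IsExponentialCocycle V ω)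
    (hω' : IsExponentialCocycle V ω')
    (h1 : ∀ x v, ⟪oneParticle v, ω x⟫_ℂ = ⟪oneParticle v, ω' x⟫_ℂ) (s : P) (v : K) {n : ℕ}
    {M M' : ℝ} (hM : ∀ k ≤ n, ‖ω (k • s)‖ ≤ M) (hM' : ∀ k ≤ n, ‖ω' (k • s)‖ ≤ M') :
    ∀ k m : ℕ, k + m = n →
      ‖⟪expVec v, ω (k • s)⟫_ℂ * ⟪expVec ((V (k • s)).adjoint v), ω' (m • s)⟫_ℂ -
        ⟪expVec v, ω' (n • s)⟫_ℂ‖ ≤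
      ‖expVec v‖ ^ 3 * M * M' * ‖ω s - ω' s‖ * (‖v‖ ^ 2 - ‖(V (k • s)).adjoint v‖ ^ 2) := by
  intro k
  induction k with
  | zero =>
    intro m hm
    obtain rfl : m = n := by omega
    rw [zero_smul, hω.inner_zero, V.adjoint_zero_apply, one_mul, sub_self, sub_self, norm_zero,
      mul_zero]
  | succ k ih =>
    intro m hm
    have h2 := ih (m + 1) (by omega)
    set w := (V (k • s)).adjoint v with hw
    have hwv : ‖w‖ ≤ ‖v‖ := norm_adjoint_le (V.isometry _) v
    have hw' : (V ((k + 1) • s)).adjoint v = (V s).adjoint w := by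
      rw [succ_nsmul, V.adjoint_add_apply]
    have hw'w : ‖(V s).adjoint w‖ ≤ ‖w‖ := norm_adjoint_le (V.isometry _) w
    -- The two hybrid products differ only in the step from k to k + 1, where ω s replaces ω' s.
    have h3 : ⟪expVec v, ω ((k + 1) • s)⟫_ℂ * ⟪expVec ((V s).adjoint w), ω' (m • s)⟫_ℂ -
        ⟪expVec v, ω' (n • s)⟫_ℂ =
        (⟪expVec v, ω (k • s)⟫_ℂ * ⟪expVec w, ω' ((m + 1) • s)⟫_ℂ - ⟪expVec v, ω' (n • s)⟫_ℂ) +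
        ⟪expVec v, ω (k • s)⟫_ℂ * (⟪expVec w, ω s⟫_ℂ - ⟪expVec w, ω' s⟫_ℂ) *
          ⟪expVec ((V s).adjoint w), ω' (m • s)⟫_ℂ := by
      rw [succ_nsmul, succ_nsmul' s m, hω.map_add, hω'.map_add]
      ring
    rw [hw', h3]
    refine (norm_add_le _ _).trans ?_
    have h4 : ‖⟪expVec v, ω (k • s)⟫_ℂ‖ ≤ ‖expVec v‖ * M :=
      (norm_inner_le_norm _ _).trans
        (mul_le_mul_of_nonneg_left (hM k (by omega)) (norm_nonneg _))
    have h5 : ‖⟪expVec ((V s).adjoint w), ω' (m • s)⟫_ℂ‖ ≤ ‖expVec v‖ * M' :=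
      (norm_inner_le_norm _ _).trans
        (mul_le_mul (norm_expVec_le_of_norm_le (hw'w.trans hwv)) (hM' m (by omega))
          (norm_nonneg _) (norm_nonneg _))
    have h6 : ‖⟪expVec w, ω s⟫_ℂ - ⟪expVec w, ω' s⟫_ℂ‖ ≤
        (‖w‖ ^ 2 - ‖(V s).adjoint w‖ ^ 2) * ‖expVec v‖ * ‖ω s - ω' s‖ := by
      refine (hω.norm_inner_sub_le hω' h1 s w).trans ?_
      rw [norm_kerProj_sq (V.isometry s)]
      refine mul_le_mul_of_nonneg_right (mul_le_mul_of_nonneg_left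
        (norm_expVec_le_of_norm_le hwv) ?_) (norm_nonneg _)
      rw [← norm_kerProj_sq (V.isometry s)]
      exact sq_nonneg _
    -- Each of the three factors contributes one ‖e(v)‖, whence the cube in the constant.
    have h7 := mul_le_mul (mul_le_mul h4 h6 (norm_nonneg _) ((norm_nonneg _).trans h4)) h5
      (norm_nonneg _) (mul_nonneg ((norm_nonneg _).trans h4) ((norm_nonneg _).trans h6))
    rw [norm_mul, norm_mul]
    refine (add_le_add h2 h7).trans (le_of_eq ?_)
    ring

/-- An exponential cocycle is determined by its one-particle component. -/
theorem IsExponentialCocycle.eq_of_oneParticle (hω : IsExponentialCocycle V ω)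
    (hω' : IsExponentialCocycle V ω')
    (h1 : ∀ x v, ⟪oneParticle v, ω x⟫_ℂ = ⟪oneParticle v, ω' x⟫_ℂ) (x : P) : ω x = ω' x := by
  refine eq_of_inner_expVec fun v => ?_
  obtain ⟨M, hM⟩ := exists_norm_le_on_segment hω.continuous x
  obtain ⟨M', hM'⟩ := exists_norm_le_on_segment hω'.continuous x
  have hM0 : 0 ≤ M := (norm_nonneg _).trans (hM 0 zero_le_one)
  have hM0' : 0 ≤ M' := (norm_nonneg _).trans (hM' 0 zero_le_one)
  set c : ℕ → {t : ℝ // 0 ≤ t} := fun n => ⟨1 / ((n : ℝ) + 1), by positivity⟩ with hc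
  have hcn : ∀ n k : ℕ, k • c n • x =
      (⟨k / ((n : ℝ) + 1), by positivity⟩ : {t : ℝ // 0 ≤ t}) • x := by
    intro n k
    refine Subtype.ext ?_
    change k • (1 / ((n : ℝ) + 1)) • (x : EuclideanSpace ℝ (Fin d)) = (k / ((n : ℝ) + 1)) • (x : _)
    rw [← Nat.cast_smul_eq_nsmul ℝ, smul_smul]
    congr 1
    ring
  have hcx : ∀ n : ℕ, (n + 1) • c n • x = x := by
    intro n
    rw [hcn]
    refine Subtype.ext ?_
    change (((n + 1 : ℕ) : ℝ) / ((n : ℝ) + 1)) • (x : EuclideanSpace ℝ (Fin d)) = x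
    rw [Nat.cast_succ, div_self (by positivity), one_smul]
  have hle : ∀ n k : ℕ, k ≤ n + 1 → (k : ℝ) / ((n : ℝ) + 1) ≤ 1 := by
    intro n k hk
    rw [div_le_one (by positivity)]
    exact_mod_cast hk
  set C := ‖expVec v‖ ^ 3 * M * M' with hC
  have hbound : ∀ n, ‖⟪expVec v, ω x⟫_ℂ - ⟪expVec v, ω' x⟫_ℂ‖ ≤
      C * ‖ω (c n • x) - ω' (c n • x)‖ * ‖v‖ ^ 2 := by
    -- All n + 1 steps are exchanged (k = n + 1, m = 0). The telescoped sum is at most ‖v‖², so only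
    -- ‖ω s - ω' s‖ still depends on n.
    intro n
    have h2 := hω.norm_telescope_le hω' h1 (c n • x) v (n := n + 1) (M := M) (M' := M')
      (fun k hk => by rw [hcn]; exact hM _ (hle n k hk))
      (fun k hk => by rw [hcn]; exact hM' _ (hle n k hk)) (n + 1) 0 rfl
    rw [hcx, zero_smul, hω'.inner_zero, mul_one] at h2
    refine h2.trans (mul_le_mul_of_nonneg_left ?_ (by positivity))
    linarith [sq_nonneg ‖(V x).adjoint v‖]
  have hlim : Tendsto (fun n => C * ‖ω (c n • x) - ω' (c n • x)‖ * ‖v‖ ^ 2) atTop (𝓝 0) := by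
    have hc0 : Tendsto c atTop (𝓝 0) :=
      tendsto_subtype_rng.2 (tendsto_one_div_add_atTop_nhds_zero_nat (𝕜 := ℝ))
    have hg : Continuous fun t : {t : ℝ // 0 ≤ t} =>
        C * ‖ω (t • x) - ω' (t • x)‖ * ‖v‖ ^ 2 :=
      (continuous_const.mul (((hω.continuous.comp (continuous_smul_cone x)).sub
        (hω'.continuous.comp (continuous_smul_cone x))).norm)).mul continuous_const
    have h0 : ω 0 = ω' 0 := eq_of_inner_expVec fun w => by rw [hω.inner_zero, hω'.inner_zero]
    have h3 := (hg.tendsto 0).comp hc0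
    have hx : (0 : {t : ℝ // 0 ≤ t}) • x = 0 :=
      Subtype.ext (zero_smul ℝ (x : EuclideanSpace ℝ (Fin d)))
    simpa [hx, h0, Function.comp_def] using h3
  exact sub_eq_zero.1 (norm_le_zero_iff.1 (ge_of_tendsto' hlim hbound))

end ExponentialCocycle


/-! ### Units of CCR flows -/

section Units

open Filter Topology

variable {K : Type u} [NormedAddCommGroup K] [InnerProductSpace ℂ K] [CompleteSpace K]
  {d : ℕ} {P : PointedCone ℝ (EuclideanSpace ℝ (Fin d))} {V : IsometricRep P K}

theorem AdditiveCocycle.ext {h h' : AdditiveCocycle V} (H : ∀ x, h.toFun x = h'.toFun x) :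
    h = h' := by
  obtain ⟨f, _, _, _⟩ := h
  obtain ⟨g, _, _, _⟩ := h'
  obtain rfl : f = g := funext H
  rfl

theorem norm_comp_tensorLeft_apply {X Y : Type u} [NormedAddCommGroup X] [InnerProductSpace ℂ X]
    [NormedAddCommGroup Y] [InnerProductSpace ℂ Y] [CompleteSpace Y]
    {W : HilbertTensor X Y →L[ℂ] Y} (hW : AdjointLeftInverse W) (ξ : X) (η : Y) :
    ‖(W ∘L tensorLeft ξ) η‖ = ‖ξ‖ * ‖η‖ := by
  have h := inner_map_tensorLeft W hW ξ ξ η η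
  rw [inner_self_eq_norm_sq_to_K, inner_self_eq_norm_sq_to_K, inner_self_eq_norm_sq_to_K,
    ← mul_pow] at h
  have h1 : ‖W (tensorLeft ξ η)‖ ^ 2 = (‖ξ‖ * ‖η‖) ^ 2 := by exact_mod_cast h
  exact (pow_left_inj₀ (norm_nonneg _) (by positivity) two_ne_zero).1 h1

variable (V) in
theorem norm_unitFamily_apply (μ : Fin d → ℂ) (h : AdditiveCocycle V) (x : P) (ξ : Fock K) :
    ‖unitFamily V μ h x ξ‖ = ‖Complex.exp (pairing μ x)‖ * (‖expVec (h.toFun x)‖ * ‖ξ‖) := by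
  refine (norm_smul (Complex.exp (pairing μ x)) _).trans (congrArg _ ?_)
  exact (norm_comp_tensorLeft_apply (adjointLeftInverse_fockUnitary (V.isometry x)) _ ξ).trans
    (congrArg (· * ‖ξ‖) (norm_expVec_coe _ ⟨h.toFun x, h.mem_ker x⟩))

variable (V) in
theorem unitFamily_expVec (μ : Fin d → ℂ) (h : AdditiveCocycle V) (x : P) (w : K) :
    unitFamily V μ h x (expVec w) =
      Complex.exp (pairing μ x) • expVec (h.toFun x + V x w) :=
  congrArg (Complex.exp (pairing μ x) • ·) (creation_expVec V x ⟨h.toFun x, h.mem_ker x⟩ w)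

theorem continuous_exp_pairing (μ : Fin d → ℂ) :
    Continuous fun x : P => Complex.exp (pairing μ x) :=
  Complex.continuous_exp.comp
    ((pairing μ).continuous_of_finiteDimensional.comp continuous_subtype_val)

/-- Continuity is explicit on the span of the exponential vectors. It passes to the closure because
the operator norms, known exactly from `norm_unitFamily_apply`, are locally bounded in x. -/
theorem continuous_unitFamily_apply (μ : Fin d → ℂ) (h : AdditiveCocycle V) (ξ : Fock K) :
    Continuous fun x => unitFamily V μ h x ξ := by
  have hspan : ∀ η ∈ Submodule.span ℂ (Set.range (expVec : K → Fock K)),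
      Continuous fun x => unitFamily V μ h x η := by
    intro η hη
    induction hη using Submodule.span_induction with
    | mem η hη =>
      obtain ⟨w, rfl⟩ := hη
      simp_rw [unitFamily_expVec]
      exact (continuous_exp_pairing μ).smul
        (continuous_expVec.comp (h.continuous.add (V.continuous w)))
    | zero => simp_rw [map_zero]; exact continuous_const
    | add a b _ _ ha hb => simp_rw [map_add]; exact ha.add hb
    | smul c a _ ha => simp_rw [map_smul]; exact ha.const_smul c
  refine continuous_iff_continuousAt.2 fun x₀ => ?_
  set C : P → ℝ := fun x => ‖Complex.exp (pairing μ x)‖ * ‖expVec (h.toFun x)‖ with hC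
  have hCc : Continuous C :=
    (continuous_exp_pairing μ).norm.mul (continuous_expVec.comp h.continuous).norm
  refine continuousAt_of_locally_uniform_approx_of_continuousAt fun U hU => ?_
  obtain ⟨ε, hε, hεU⟩ := Metric.mem_uniformity_dist.1 hU
  have hC0 : 0 < C x₀ + 1 := by positivity
  have hd := Submodule.dense_iff_topologicalClosure_eq_top.2 (span_expVec (K := K))
  obtain ⟨η, hη, hηd⟩ := Metric.dense_iff.1 hd ξ (ε / (C x₀ + 1)) (by positivity)
  refine ⟨{x | C x < C x₀ + 1}, (hCc.tendsto x₀).eventually (gt_mem_nhds (by linarith)),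
    fun x => unitFamily V μ h x η, (hspan η hηd).continuousAt, fun x hx => hεU ?_⟩
  rw [dist_eq_norm, ← map_sub, norm_unitFamily_apply, ← mul_assoc]
  have h1 : ‖ξ - η‖ < ε / (C x₀ + 1) := by
    rw [← dist_eq_norm, dist_comm]
    exact hη
  calc C x * ‖ξ - η‖ ≤ (C x₀ + 1) * ‖ξ - η‖ :=
        mul_le_mul_of_nonneg_right (le_of_lt hx) (norm_nonneg _)
    _ < (C x₀ + 1) * (ε / (C x₀ + 1)) := mul_lt_mul_of_pos_left h1 hC0
    _ = ε := mul_div_cancel₀ _ hC0.ne'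

theorem isUnitOf_unitFamily (μ : Fin d → ℂ) (h : AdditiveCocycle V) :
    IsUnitOf (ccrFlow V) (unitFamily V μ h) where
  continuous := continuous_unitFamily_apply μ h
  intertwines x T := by
    rw [unitFamily, ContinuousLinearMap.comp_smul, ccrFlow_comp_creation,
      ContinuousLinearMap.smul_comp]
  map_add x y := by
    refine clm_ext_expVec fun w => ?_
    rw [ContinuousLinearMap.comp_apply, unitFamily_expVec, unitFamily_expVec, map_smul,
      unitFamily_expVec, smul_smul, ← Complex.exp_add, h.map_add, V.map_add, map_add (V x),
      ContinuousLinearMap.comp_apply, add_assoc, add_comm (pairing μ y), ← map_add (pairing μ)]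
    rfl
  nonzero := by
    refine ⟨0, fun h0 => ?_⟩
    have h1 := norm_unitFamily_apply V μ h 0 (expVec 0)
    rw [h0, zero_apply, norm_zero] at h1
    have h2 : ∀ v : K, 0 < ‖expVec v‖ := fun v =>
      norm_pos_iff.2 fun hv => (Real.exp_pos (‖v‖ ^ 2)).ne (by rw [← norm_expVec_sq, hv]; simp)
    have h3 : 0 < ‖Complex.exp (pairing μ (0 : P))‖ := norm_pos_iff.2 (Complex.exp_ne_zero _)
    exact (mul_pos h3 (mul_pos (h2 _) (h2 _))).ne h1

/-- Evaluated at e(0), the vacuum component determines the character and hence μ; the one-particle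
component then determines h. -/
theorem unitFamily_injective
    (hP : ∀ z : EuclideanSpace ℝ (Fin d), ∃ x ∈ P, ∃ y ∈ P, z = x - y) {μ μ' : Fin d → ℂ}
    {h h' : AdditiveCocycle V} (H : unitFamily V μ h = unitFamily V μ' h') :
    μ = μ' ∧ h = h' := by
  have h1 : ∀ x : P, Complex.exp (pairing μ x) • expVec (h.toFun x) =
      Complex.exp (pairing μ' x) • expVec (h'.toFun x) := by
    intro x
    have h2 := congrArg (fun A => A (expVec 0)) (congrFun H x)
    simpa only [unitFamily_expVec, map_zero, add_zero] using h2
  have h2 : ∀ x : P, Complex.exp (pairing μ x) = Complex.exp (pairing μ' x) := by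
    intro x
    have h3 := congrArg (fun ξ => ⟪expVec (0 : K), ξ⟫_ℂ) (h1 x)
    simpa only [inner_smul_right, inner_expVec, inner_zero_left, Complex.exp_zero, mul_one] using h3
  refine ⟨eq_of_exp_pairing_eq hP h2, AdditiveCocycle.ext fun x => ext_inner_left ℂ fun v => ?_⟩
  have h3 := congrArg (fun ξ => ⟪oneParticle v, ξ⟫_ℂ) (h1 x)
  simp only [inner_smul_right, inner_oneParticle_expVec, h2] at h3
  exact mul_left_cancel₀ (Complex.exp_ne_zero _) h3

/-- The vacuum expectation of a unit is multiplicative. -/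
theorem IsUnitOf.vacuum_add {u : P → Fock K →L[ℂ] Fock K} (hu : IsUnitOf (ccrFlow V) u) (x y : P)
    (v : K) : ⟪expVec v, u (x + y) (expVec 0)⟫_ℂ =
      ⟪expVec v, u x (expVec 0)⟫_ℂ * ⟪expVec ((V x).adjoint v), u y (expVec 0)⟫_ℂ := by
  rw [hu.map_add, ContinuousLinearMap.comp_apply]
  exact inner_expVec_of_intertwines V x (u x) (hu.intertwines x) v _

/-- The value c satisfies c = c². As ker V_0* = 0, the operator u_0 is the scalar c, so c = 0 would
force u_x = u_0 u_x = 0 for every x. -/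
theorem IsUnitOf.vacuum_zero {u : P → Fock K →L[ℂ] Fock K} (hu : IsUnitOf (ccrFlow V) u) :
    ⟪expVec 0, u 0 (expVec 0)⟫_ℂ = 1 := by
  have h1 := hu.vacuum_add 0 0 0
  rw [add_zero, map_zero] at h1
  have h2 : ⟪expVec 0, u 0 (expVec 0)⟫_ℂ ≠ 0 := by
    intro h0
    have h3 : u 0 = 0 := by
      refine ContinuousLinearMap.ext fun η => eq_of_inner_expVec fun v => ?_
      rw [inner_expVec_of_intertwines V 0 (u 0) (hu.intertwines 0),
        ← inner_expVec_kerProj_of_intertwines V 0 (u 0) (hu.intertwines 0), kerProj_zero_apply, h0,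
        zero_mul, zero_apply, inner_zero_right]
    obtain ⟨x, hx⟩ := hu.nonzero
    refine hx ?_
    rw [← zero_add x, hu.map_add, h3, ContinuousLinearMap.zero_comp]
  exact (mul_left_cancel₀ h2 (by rw [mul_one]; exact h1)).symm

theorem IsUnitOf.exists_eq_unitFamily
    (hP : ∀ z : EuclideanSpace ℝ (Fin d), ∃ x ∈ P, ∃ y ∈ P, z = x - y)
    {u : P → Fock K →L[ℂ] Fock K} (hu : IsUnitOf (ccrFlow V) u) :
    ∃ μ h, unitFamily V μ h = u := by
  obtain ⟨μ, hμ⟩ := exists_eq_exp_pairing hP (fun x => ⟪expVec (0 : K), u x (expVec 0)⟫_ℂ)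
    (continuous_const.inner (hu.continuous _)) hu.vacuum_zero (fun x y => by
      have h := hu.vacuum_add x y 0
      rwa [map_zero] at h)
  have hω : IsExponentialCocycle V fun x => Complex.exp (-pairing μ x) • u x (expVec 0) :=
    { continuous := by
        have h1 := continuous_exp_pairing (P := P) (-μ)
        have h2 : ∀ x : EuclideanSpace ℝ (Fin d), pairing (-μ) x = -pairing μ x := fun x => by
          simp [pairing_apply]
        simp_rw [h2] at h1
        exact h1.smul (hu.continuous _)
      vacuum := fun x => by
        rw [inner_smul_right, hμ x, ← Complex.exp_add, neg_add_cancel, Complex.exp_zero]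
      kerProj := fun x v => by
        rw [inner_smul_right, inner_smul_right,
          inner_expVec_kerProj_of_intertwines V x (u x) (hu.intertwines x)]
      map_add := fun x y v => by
        rw [inner_smul_right, inner_smul_right, inner_smul_right, hu.vacuum_add,
          Submodule.coe_add, _root_.map_add, neg_add, Complex.exp_add]
        ring }
  refine ⟨μ, hω.additiveCocycle, funext fun x => clm_ext_expVec fun w => ?_⟩
  have h1 := hω.eq_of_oneParticle (isExponentialCocycle_expVec V hω.additiveCocycle)
    (fun x v => by rw [inner_oneParticle_expVec, hω.inner_additiveCocycle]) x
  have h2 : u x (expVec 0) =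
      Complex.exp (pairing μ x) • expVec (hω.additiveCocycle.toFun x) := by
    rw [← h1, smul_smul, ← Complex.exp_add, add_neg_cancel, Complex.exp_zero, one_smul]
  -- An intertwiner is recovered from its value at e(0), so agreement there gives agreement on every
  -- e(w).
  refine eq_of_inner_expVec fun v => ?_
  rw [inner_expVec_of_intertwines V x (u x) (hu.intertwines x) v (expVec w), h2, unitFamily_expVec,
    inner_smul_right, inner_smul_right, inner_expVec, inner_expVec, inner_expVec, mul_assoc,
    inner_add_right, Complex.exp_add ⟪v, _⟫_ℂ, ContinuousLinearMap.adjoint_inner_left]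

end Units

end CCR

end

/-! ### The parametrisation of the units. -/

theorem mainTheorem4 {d : ℕ} (P : PointedCone ℝ (EuclideanSpace ℝ (Fin d)))
    (hP_closed : IsClosed (P : Set (EuclideanSpace ℝ (Fin d))))
    (hP_spanning : ∀ z : EuclideanSpace ℝ (Fin d), ∃ x ∈ P, ∃ y ∈ P, z = x - y)
    (hP_pointed : ∀ x ∈ P, -x ∈ P → x = 0)
    {K : Type u} [NormedAddCommGroup K] [InnerProductSpace ℂ K] [CompleteSpace K]
    [TopologicalSpace.SeparableSpace K]
    (V : CCR.IsometricRep P K) (hV_strict : V.StrictlyContinuous) (hV_pure : V.Pure) :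
    Set.BijOn (fun p : (Fin d → ℂ) × CCR.AdditiveCocycle V => CCR.unitFamily V p.1 p.2)
      Set.univ (CCR.units (CCR.ccrFlow V)) := by
  refine ⟨fun p _ => CCR.isUnitOf_unitFamily p.1 p.2, ?_, fun u hu => ?_⟩
  · rintro ⟨μ, h⟩ - ⟨μ', h'⟩ - H
    obtain ⟨rfl, rfl⟩ := CCR.unitFamily_injective hP_spanning H
    rfl
  · obtain ⟨μ, h, rfl⟩ := CCR.IsUnitOf.exists_eq_unitFamily hP_spanning hu
    exact ⟨(μ, h), trivial, rfl⟩
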